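/- Let $\mathcal W_2(\mathbb R)$ be the set of probability measures on $\mathbb R$ with finite second moment, with the quadratic Wasserstein distance $W_2(\mu,\nu)=\bigl(\inf_\pi\int|x-y|^2\,d\pi(x,y)\bigr)^{1/2}$, the infimum being over all couplings $\pi$ of $\mu$ and $\nu$. Let $\Theta\subset\mathbb R^p$ and, for each $\theta\in\Theta$, let $K_\theta$ be a covariance function on $\mathcal W_2(\mathbb R)$, that is, a symmetric function $\mathcal W_2(\mathbb R)\times\mathcal W_2(\mathbb R)\to\mathbb R$ with $\sum_{i,j=1}^m\lambda_i\lambda_jK_\theta(\nu_i,\nu_j)\ge 0$ for all $m$, all $\nu_1,\dots,\nu_m\in\mathcal W_2(\mathbb R)$ and all $\lambda_1,\dots,\lambda_m\in\mathbb R$. Let $(\mu_i^{(n)})_{1\le i\le n,\ n\in\mathbb N}$ be a triangular array in $\mathcal W_2(\mathbb R)$, abbreviated $\mu_i=\mu_i^{(n)}$, and let $R_\theta=[K_\theta(\mu_i,\mu_j)]_{1\le i,j\le n}$. Assume: 1. There is $L<\infty$ such that for all $n$ and all $1\le i\le n$, $\mu_i^{(n)}$ has support in $[i,i+L]$. 2.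 There are functions $F_\theta:[0,\infty)\to\mathbb R$ and constants $A<\infty$, $\tau>1$ such that $K_\theta(\mu,\nu)=F_\theta(W_2(\mu,\nu))$ for all $\theta\in\Theta$ and $\mu,\nu\in\mathcal W_2(\mathbb R)$, and $\sup_{\theta\in\Theta}|F_\theta(t)|\le A/(1+|t|^{1+\tau})$ for all $t\ge0$. 3. $\theta_0\in\Theta$, and the observations are $y_i=Y(\mu_i)$, $i=1,\dots,n$, where $Y$ is a centered Gaussian process indexed by $\mathcal W_2(\mathbb R)$ with covariance function $K_{\theta_0}$. 4. There is $c>0$ such that for all $n$ and all $\theta\in\Theta$ the smallest eigenvalue of $R_\theta$ is at least $c$. 5. For every $\alpha>0$, $$\liminf_{n\to\infty}\ \inf_{\theta\in\Theta,\ \|\theta-\theta_0\|\ge\alpha}\ \frac1n\sum_{i,j=1}^n\bigl[K_\theta(\mu_i,\mu_j)-K_{\theta_0}(\mu_i,\mu_j)\bigr]^2>0,$$ where the infimum over the empty set is $+\infty$. For each $n$ let $\hat\theta_{ML}=\hat\theta_{ML}^{(n)}$ be a maximum likelihood estimator: almost surely, $\hat\theta_{ML}$ is a minimizer over $\theta\in\Theta$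 of $$L_\theta=\frac1n\ln(\det R_\theta)+\frac1n\,y^tR_\theta^{-1}y,\qquad y=(y_1,\dots,y_n)^t.$$ Then $\hat\theta_{ML}\to\theta_0$ in probability as $n\to\infty$. -/

import Mathlib

open MeasureTheory ProbabilityTheory Filter

noncomputable section

namespace WassersteinGP

/-- The set of probability measures on the real line with a finite moment of order two. -/
abbrev WassersteinSpace : Type :=
  {μ : ProbabilityMeasure ℝ // Integrable (fun x : ℝ => x ^ 2) (μ : Measure ℝ)}

/-- The measure on the real line underlying an element of the Wasserstein space. -/
abbrev WassersteinSpace.measure (μ : WassersteinSpace) : Measure ℝ := (μ.1 : Measure ℝ)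

/-- The couplings of `μ` and `ν`: measures on the product with first marginal `μ` and second
marginal `ν` (they have total mass one, because `μ` does). -/
def couplings (μ ν : WassersteinSpace) : Set (Measure (ℝ × ℝ)) :=
  {π | π.fst = μ.measure ∧ π.snd = ν.measure}

/-- The quadratic transportation cost. The infimum is over a nonempty set of nonnegative reals, and
the integrand is integrable for each coupling because both marginals have a second moment. -/
def transportCost (μ ν : WassersteinSpace) : ℝ :=
  sInf ((fun π : Measure (ℝ × ℝ) => ∫ z, |z.1 - z.2| ^ 2 ∂π) '' couplings μ ν)

/-- The quadratic Wasserstein distance. -/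
def W2 (μ ν : WassersteinSpace) : ℝ := Real.sqrt (transportCost μ ν)

/-- `K` is a covariance function (a symmetric positive definite kernel) on `E`. -/
def IsCovarianceFunction {E : Type*} (K : E → E → ℝ) : Prop :=
  (∀ x y, K x y = K y x) ∧
    ∀ (n : ℕ) (x : Fin n → E) (l : Fin n → ℝ), 0 ≤ ∑ i, ∑ j, l i * l j * K (x i) (x j)

/-- The matrix `[k (μ i) (μ j)]` of a kernel `k` at finitely many points. -/
def covMatrix {E : Type*} {n : ℕ} (k : E → E → ℝ) (x : Fin n → E) : Matrix (Fin n) (Fin n) ℝ :=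
  Matrix.of fun i j => k (x i) (x j)

/-- The criterion `(1/n) ln (det R) + (1/n) yᵗ R⁻¹ y` of a covariance matrix `R` and a vector `y`
of observations, which maximum likelihood minimises. -/
def likelihoodCriterion {n : ℕ} (R : Matrix (Fin n) (Fin n) ℝ) (y : Fin n → ℝ) : ℝ :=
  1 / (n : ℝ) * Real.log R.det + 1 / (n : ℝ) * (y ⬝ᵥ (R⁻¹).mulVec y)

/-- `θ` is a maximum likelihood estimate over `Θ`, given the points `x` and the values `y`. -/
def IsMaximumLikelihood {E V : Type*} {n : ℕ} (K : V → E → E → ℝ) (Θ : Set V)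
    (x : Fin n → E) (y : Fin n → ℝ) (θ : V) : Prop :=
  θ ∈ Θ ∧ ∀ θ' ∈ Θ,
    likelihoodCriterion (covMatrix (K θ) x) y ≤ likelihoodCriterion (covMatrix (K θ') x) y

/-- `Y` is a centered Gaussian process with covariance function `k`. -/
def IsCenteredGaussianProcess {E Ω : Type*} [MeasurableSpace Ω] (Y : E → Ω → ℝ)
    (k : E → E → ℝ) (P : Measure Ω) : Prop :=
  IsGaussianProcess Y P ∧ (∀ x, ∫ ω, Y x ω ∂P = 0) ∧ ∀ x x', cov[Y x, Y x'; P] = k x x'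

/-- In the triangular array `μ`, the `i`-th measure of each row has support in `[i, i + L]`.
The points are numbered from one, so the index `i : Fin n` stands for the number `i + 1`. -/
def ShiftedSupports (μ : (n : ℕ) → Fin n → WassersteinSpace) : Prop :=
  ∃ L : ℝ, ∀ (n : ℕ) (i : Fin n),
    (μ n i).measure.support ⊆ Set.Icc ((i : ℝ) + 1) ((i : ℝ) + 1 + L)

/-- Over `Θ`, the covariance is a function `F θ` of the Wasserstein distance, with polynomial decay
uniform in `θ`. Only the values of `F θ` on the nonnegative half line matter. -/
def StationaryWithDecay {V : Type*} (K : V → WassersteinSpace → WassersteinSpace → ℝ)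
    (Θ : Set V) : Prop :=
  ∃ (F : V → ℝ → ℝ) (A τ : ℝ), 1 < τ ∧
    (∀ θ ∈ Θ, ∀ μ ν, K θ μ ν = F θ (W2 μ ν)) ∧
    ∀ θ ∈ Θ, ∀ t : ℝ, 0 ≤ t → |F θ t| ≤ A / (1 + |t| ^ (1 + τ))

/-- The eigenvalues of all the covariance matrices are at least some fixed `c > 0`. -/
def EigenvaluesBoundedBelow {E V : Type*} (K : V → E → E → ℝ) (Θ : Set V)
    (x : (n : ℕ) → Fin n → E) : Prop :=
  ∃ c : ℝ, 0 < c ∧ ∀ (n : ℕ), ∀ θ ∈ Θ, ∀ r : ℝ,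
    Module.End.HasEigenvalue (Matrix.toLin' (covMatrix (K θ) (x n))) r → c ≤ r

/-- Asymptotic identifiability of `θ₀`. The infimum is taken in the extended reals, so that it is
`+∞` when no parameter is at distance at least `α` from `θ₀`. -/
def AsymptoticallyIdentifiable {E V : Type*} [NormedAddCommGroup V] (K : V → E → E → ℝ)
    (Θ : Set V) (x : (n : ℕ) → Fin n → E) (θ₀ : V) : Prop :=
  ∀ α : ℝ, 0 < α →
    (0 : EReal) < liminf (fun n : ℕ => ⨅ θ ∈ {θ : V | θ ∈ Θ ∧ α ≤ ‖θ - θ₀‖},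
      ((1 / (n : ℝ) * ∑ i, ∑ j, (K θ (x n i) (x n j) - K θ₀ (x n i) (x n j)) ^ 2 : ℝ) : EReal))
      atTop

end WassersteinGP

end

noncomputable section

namespace WassersteinGP

/-! The mean of n(L_θ − L_θ₀) is ln det R_θ − ln det R_θ₀ + tr(R_θ⁻¹R_θ₀) − n, twice a
Kullback-Leibler divergence. When both spectra lie in [c, C], where C comes from the summable decay,
it dominates a multiple of the squared Frobenius distance (`frobenius_le_kullbackLeibler`), so by
identifiability it has order n away from θ₀. Consistency thus reduces to a uniform law: yᵗR_θ⁻¹y −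
tr(R_θ⁻¹R_θ₀) is o(n) in probability, uniformly in θ (`tendsto_measure_exists_deviation`).

Neither smoothness in θ nor compactness of Θ is available; uniformity comes from monotonicity. All
finite Euclidean configurations embed isometrically in the Wasserstein space
(`exists_isometric_family`), which forces F_θ to be nonincreasing
(`IsCovarianceFunction.antitoneOn`), and nonnegative because it decays. The superlevel sets of all
the F_θ among the index pairs then form a chain, so their approximate cardinalities determine them
up to few pairs. Decay leaves only a band of O(n) relevant pairs, so a number of classes independent
of n fixes R_θ up to an entrywise error of total mass ηn (`exists_bracketing_matrix`). In each class
R_θ⁻¹ lies between M − N and M + N as a quadratic form, with tr(N R_θ₀) ≤ εn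
(`exists_bracketing_inverse`). Chebyshev's inequality for these finitely many forms, whose variances
are O(n), concludes. -/

/-! ### Optimal transport and Euclidean configurations -/

lemma integrable_sq_sub_of_mem_couplings {μ ν : WassersteinSpace} {π : Measure (ℝ × ℝ)}
    (hπ : π ∈ couplings μ ν) : Integrable (fun z : ℝ × ℝ => |z.1 - z.2| ^ 2) π := by
  have h1 : Integrable (fun z : ℝ × ℝ => z.1 ^ 2) π := by
    have h := μ.2
    change Integrable _ μ.measure at h
    rw [← hπ.1] at h
    exact h.comp_measurable measurable_fst
  have h2 : Integrable (fun z : ℝ × ℝ => z.2 ^ 2) π := by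
    have h := ν.2
    change Integrable _ ν.measure at h
    rw [← hπ.2] at h
    exact h.comp_measurable measurable_snd
  refine ((h1.add h2).const_mul 2).mono' (by fun_prop) (ae_of_all _ fun z => ?_)
  rw [Real.norm_eq_abs, abs_of_nonneg (by positivity), sq_abs]
  simp only [Pi.add_apply]
  nlinarith [sq_nonneg (z.1 + z.2)]

lemma bddBelow_transportCost (μ ν : WassersteinSpace) :
    BddBelow ((fun π : Measure (ℝ × ℝ) => ∫ z, |z.1 - z.2| ^ 2 ∂π) '' couplings μ ν) :=
  ⟨0, by rintro _ ⟨π, -, rfl⟩; exact integral_nonneg fun z => by positivity⟩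

lemma prod_mem_couplings (μ ν : WassersteinSpace) :
    μ.measure.prod ν.measure ∈ couplings μ ν := by
  constructor <;> simp [WassersteinSpace.measure]

/-- A dual lower bound of the transportation cost. -/
lemma integral_le_transportCost {μ ν : WassersteinSpace} {S T : Set ℝ} {φ : ℝ → ℝ}
    (hS : ∀ᵐ x ∂μ.measure, x ∈ S) (hT : ∀ᵐ y ∂ν.measure, y ∈ T)
    (hφ : Integrable φ μ.measure) (h : ∀ x ∈ S, ∀ y ∈ T, φ x ≤ |x - y| ^ 2) :
    ∫ x, φ x ∂μ.measure ≤ transportCost μ ν := by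
  refine le_csInf ⟨_, Set.mem_image_of_mem _ (prod_mem_couplings μ ν)⟩ ?_
  rintro _ ⟨π, hπ, rfl⟩
  have hπ1 : π.map Prod.fst = μ.measure := hπ.1
  have hπ2 : π.map Prod.snd = ν.measure := hπ.2
  rw [← hπ1] at hS hφ ⊢
  rw [← hπ2] at hT
  rw [integral_map measurable_fst.aemeasurable hφ.1]
  refine integral_mono_ae (hφ.comp_measurable measurable_fst)
    (integrable_sq_sub_of_mem_couplings hπ) ?_
  filter_upwards [ae_of_ae_map measurable_fst.aemeasurable hS,
    ae_of_ae_map measurable_snd.aemeasurable hT] with z h1 h2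
  exact h _ h1 _ h2

/-- The uniform distribution on `N + 1` points of the line. -/
def uniformOn {N : ℕ} (x : Fin (N + 1) → ℝ) : WassersteinSpace :=
  ⟨⟨(PMF.uniformOfFintype (Fin (N + 1))).toMeasure.map x,
    Measure.isProbabilityMeasure_map (measurable_of_finite x).aemeasurable⟩, by
    change Integrable _ ((PMF.uniformOfFintype (Fin (N + 1))).toMeasure.map x)
    rw [integrable_map_measure (by fun_prop) (measurable_of_finite x).aemeasurable]
    exact Integrable.of_finite⟩

lemma integral_uniformOfFintype {N : ℕ} (f : Fin (N + 1) → ℝ) :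
    ∫ i, f i ∂(PMF.uniformOfFintype (Fin (N + 1))).toMeasure = (N + 1 : ℝ)⁻¹ * ∑ i, f i := by
  rw [PMF.integral_eq_sum, Finset.mul_sum]
  refine Finset.sum_congr rfl fun i _ => ?_
  simp [ENNReal.toReal_add]

lemma measure_uniformOn {N : ℕ} (x : Fin (N + 1) → ℝ) :
    (uniformOn x).measure = (PMF.uniformOfFintype (Fin (N + 1))).toMeasure.map x := rfl

/-- If the diagonal pairing is a nearest point pairing, it is optimal. -/
lemma transportCost_uniformOn {N : ℕ} (x y : Fin (N + 1) → ℝ)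
    (h : ∀ i j, |x i - y i| ≤ |x i - y j|) :
    transportCost (uniformOn x) (uniformOn y) = (N + 1 : ℝ)⁻¹ * ∑ i, (x i - y i) ^ 2 := by
  have hx := measurable_of_finite x
  have hy := measurable_of_finite y
  apply le_antisymm
  · refine csInf_le (bddBelow_transportCost _ _)
      ⟨(PMF.uniformOfFintype (Fin (N + 1))).toMeasure.map (fun i => (x i, y i)), ⟨?_, ?_⟩, ?_⟩
    · rw [Measure.fst_map_prodMk hy, measure_uniformOn]
    · rw [Measure.snd_map_prodMk hx, measure_uniformOn]
    · simp only
      rw [integral_map (measurable_of_finite _).aemeasurable (by fun_prop),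
        integral_uniformOfFintype]
      simp only [sq_abs]
  -- The potential, the squared distance to the target points, integrates to the diagonal cost
  -- exactly because each `y i` is nearest to `x i`.
  · have key := integral_le_transportCost (μ := uniformOn x) (ν := uniformOn y)
      (S := Set.range x) (T := Set.range y)
      (φ := fun t => Metric.infDist t (Set.range y) ^ 2) ?_ ?_ ?_ ?_
    · refine le_trans (le_of_eq ?_) key
      rw [measure_uniformOn, integral_map hx.aemeasurable (by fun_prop), integral_uniformOfFintype]
      congr 1
      refine Finset.sum_congr rfl fun i _ => ?_
      have : Metric.infDist (x i) (Set.range y) = |x i - y i| := by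
        apply le_antisymm
        · exact Metric.infDist_le_dist_of_mem ⟨i, rfl⟩
        · rw [Metric.le_infDist (Set.range_nonempty y)]
          rintro _ ⟨j, rfl⟩
          exact h i j
      rw [this, sq_abs]
    · exact (ae_map_iff hx.aemeasurable (Set.finite_range x).measurableSet).2
        (ae_of_all _ fun i => ⟨i, rfl⟩)
    · exact (ae_map_iff hy.aemeasurable (Set.finite_range y).measurableSet).2
        (ae_of_all _ fun i => ⟨i, rfl⟩)
    · rw [measure_uniformOn, integrable_map_measure (by fun_prop) hx.aemeasurable]
      exact Integrable.of_finite
    · intro s _ t ht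
      exact pow_le_pow_left₀ Metric.infDist_nonneg (Metric.infDist_le_dist_of_mem ht) 2

/-- Every finite configuration of a Euclidean space embeds isometrically in the Wasserstein
space of the line. -/
lemma exists_isometric_family {ι : Type*} [Finite ι] {N : ℕ} (v : ι → Fin (N + 1) → ℝ) :
    ∃ ν : ι → WassersteinSpace, ∀ k l, W2 (ν k) (ν l) = Real.sqrt (∑ i, (v k i - v l i) ^ 2) := by
  have hN : (0 : ℝ) < N + 1 := by positivity
  set s : ℝ := Real.sqrt (N + 1)
  have hs : s ^ 2 = N + 1 := Real.sq_sqrt hN.le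
  obtain ⟨H, hH⟩ : ∃ H : ℝ, ∀ p : ι × Fin (N + 1), |s * v p.1 p.2| ≤ H := by
    obtain ⟨H, hH⟩ := (Set.finite_range fun p : ι × Fin (N + 1) => |s * v p.1 p.2|).bddAbove
    exact ⟨H, fun p => hH ⟨p, rfl⟩⟩
  -- The factor `s` cancels the weight 1/(N + 1). The spacing `4 * H` exceeds the perturbations
  -- enough that matching atoms, at most `2 * H` apart, are nearest to each other.
  refine ⟨fun k => uniformOn fun i => 4 * H * (i : ℝ) + s * v k i, fun k l => ?_⟩
  rw [W2, transportCost_uniformOn]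
  · congr 1
    rw [Finset.mul_sum]
    refine Finset.sum_congr rfl fun i _ => ?_
    rw [show (4 * H * (i : ℝ) + s * v k i - (4 * H * (i : ℝ) + s * v l i)) ^ 2
      = s ^ 2 * (v k i - v l i) ^ 2 by ring, hs]
    field_simp
  · intro i j
    by_cases hij : i = j
    · rw [hij]
    have h1 := abs_le.1 (hH (k, i))
    have h2 := abs_le.1 (hH (l, i))
    have h3 := abs_le.1 (hH (l, j))
    have hH0 : 0 ≤ H := (abs_nonneg _).trans (hH (k, i))
    have hle : |4 * H * (i : ℝ) + s * v k i - (4 * H * (i : ℝ) + s * v l i)| ≤ 2 * H := by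
      rw [abs_le]; constructor <;> linarith [h1.1, h1.2, h2.1, h2.2]
    refine hle.trans ?_
    rcases lt_or_gt_of_ne hij with hlt | hlt
    · have : (i : ℝ) + 1 ≤ j := by exact_mod_cast hlt
      have := mul_le_mul_of_nonneg_left this hH0
      rw [abs_sub_comm]
      refine le_trans ?_ (le_abs_self _)
      linarith [h1.1, h1.2, h3.1, h3.2]
    · have : (j : ℝ) + 1 ≤ i := by exact_mod_cast hlt
      have := mul_le_mul_of_nonneg_left this hH0
      refine le_trans ?_ (le_abs_self _)
      linarith [h1.1, h1.2, h3.1, h3.2]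

lemma exists_isometric_family_of_fintype {ι J : Type*} [Finite ι] [Fintype J] [Nonempty J] (v : ι → J → ℝ) :
    ∃ ν : ι → WassersteinSpace, ∀ k l, W2 (ν k) (ν l) = Real.sqrt (∑ i, (v k i - v l i) ^ 2) := by
  obtain ⟨N, hN⟩ := Nat.exists_eq_succ_of_ne_zero (Fintype.card_ne_zero (α := J))
  let e : Fin (N + 1) ≃ J := (Fintype.equivFinOfCardEq hN).symm
  obtain ⟨ν, hν⟩ := exists_isometric_family fun k i => v k (e i)
  exact ⟨ν, fun k l => by rw [hν, ← e.sum_comp fun i => (v k i - v l i) ^ 2]⟩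

/-! ### Monotonicity of stationary covariances, and separated supports -/

lemma IsCovarianceFunction.sum_nonneg {E ι : Type*} [Fintype ι] {K : E → E → ℝ}
    (hK : IsCovarianceFunction K) (x : ι → E) (l : ι → ℝ) :
    0 ≤ ∑ i, ∑ j, l i * l j * K (x i) (x j) := by
  let e : Fin (Fintype.card ι) ≃ ι := (Fintype.equivFin ι).symm
  have := hK.2 _ (x ∘ e) (l ∘ e)
  rw [← e.sum_comp]
  simp_rw [← e.sum_comp fun j => l _ * l j * K (x _) (x j)]
  exact this

/-- Two groups of `m` points with mutual distance `t` within a group and `s` across groups. -/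
lemma exists_two_groups (m : ℕ) {s t : ℝ} (ht : 0 ≤ t) (hts : t ≤ s) :
    ∃ ν : Bool × Fin m → WassersteinSpace, ∀ p q,
      W2 (ν p) (ν q) = if p = q then 0 else if p.1 = q.1 then t else s := by
  obtain ⟨ν, hν⟩ := exists_isometric_family_of_fintype (ι := Bool × Fin m) (J := Option (Bool × Fin m))
    -- The vertices of a simplex of side `t`, with one extra coordinate that moves the two groups
    -- apart.
    fun p j => j.elim (if p.1 then Real.sqrt (s ^ 2 - t ^ 2) else 0)
      fun j => if j = p then t / Real.sqrt 2 else 0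
  refine ⟨ν, fun p q => ?_⟩
  rw [hν, Fintype.sum_option]
  by_cases hpq : p = q
  · simp [hpq]
  have hr : (t / Real.sqrt 2) ^ 2 = t ^ 2 / 2 := by
    rw [div_pow, Real.sq_sqrt (by norm_num)]
  have h1 : ∑ j, ((if j = p then t / Real.sqrt 2 else 0) -
      (if j = q then t / Real.sqrt 2 else 0)) ^ 2 = t ^ 2 := by
    simp_rw [sub_sq, Finset.sum_add_distrib, Finset.sum_sub_distrib, mul_ite, ite_pow, mul_zero,
      hr]
    simp [Ne.symm hpq]
  simp only [Option.elim_none, Option.elim_some, h1, hpq, if_false]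
  have hst : (Real.sqrt (s ^ 2 - t ^ 2)) ^ 2 = s ^ 2 - t ^ 2 :=
    Real.sq_sqrt (by nlinarith)
  obtain ⟨b, k⟩ := p
  obtain ⟨b', k'⟩ := q
  cases b <;> cases b' <;> simp [hst, Real.sqrt_sq ht, Real.sqrt_sq (ht.trans hts)]

/-- A stationary covariance function on the Wasserstein space is nonincreasing in the distance. -/
lemma IsCovarianceFunction.antitoneOn {K : WassersteinSpace → WassersteinSpace → ℝ}
    (hK : IsCovarianceFunction K) {F : ℝ → ℝ} (hF : ∀ μ ν, K μ ν = F (W2 μ ν)) :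
    AntitoneOn F (Set.Ici 0) := by
  intro t ht s _ hts
  by_contra! hlt
  obtain ⟨m, hm⟩ := exists_nat_gt ((F 0 - F t) / (F s - F t))
  rw [div_lt_iff₀ (by linarith)] at hm
  obtain ⟨ν, hν⟩ := exists_two_groups (m + 1) ht hts
  -- With weights ±1 on the two groups, the form is 2(m+1)(F 0 − F t) + 2(m+1)²(F t − F s), negative
  -- for this `m` if F t < F s.
  have key := hK.sum_nonneg ν fun p => if p.1 then 1 else -1
  have : ∀ p q : Bool × Fin (m + 1),
      (if p.1 then (1 : ℝ) else -1) * (if q.1 then 1 else -1) * K (ν p) (ν q)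
        = (if p.1 = q.1 then F t else -F s) + if p = q then F 0 - F t else 0 := by
    intro p q
    rw [hF, hν]
    by_cases hpq : p = q
    · subst hpq
      cases p.1 <;> simp
    · obtain ⟨b, k⟩ := p
      obtain ⟨b', k'⟩ := q
      cases b <;> cases b' <;> simp [hpq]
  simp_rw [this, Finset.sum_add_distrib] at key
  simp only [Fintype.sum_prod_type, Fintype.sum_bool] at key
  simp only [Finset.sum_const, Finset.card_univ, Fintype.card_fin, Prod.mk.injEq, true_and,
    Bool.true_eq_false, Bool.false_eq_true, false_and, if_true, if_false, Finset.sum_ite_eq,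
    Finset.mem_univ, smul_zero, nsmul_eq_mul] at key
  push_cast at key
  nlinarith

/-- Supports that are far apart make the Wasserstein distance large. -/
lemma le_W2_of_support {μ ν : WassersteinSpace} {d : ℝ} (hd : 0 ≤ d)
    (h : ∀ x ∈ μ.measure.support, ∀ y ∈ ν.measure.support, d ≤ |x - y|) : d ≤ W2 μ ν := by
  refine Real.le_sqrt_of_sq_le ?_
  have := integral_le_transportCost (μ := μ) (ν := ν) (φ := fun _ => d ^ 2)
    Measure.support_mem_ae Measure.support_mem_ae (integrable_const _)
    fun x hx y hy => pow_le_pow_left₀ hd (h x hx y hy) 2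
  simpa [WassersteinSpace.measure] using this

/-! ### Inequalities for quadratic forms -/

open Matrix

open scoped MatrixOrder in
lemma exists_eq_transpose_mul_self {ι : Type*} [Fintype ι] [DecidableEq ι]
    {R : Matrix ι ι ℝ} (hR : R.PosSemidef) :
    ∃ B : Matrix ι ι ℝ, R = Bᵀ * B := by
  obtain ⟨B, hB⟩ := CStarAlgebra.nonneg_iff_eq_star_mul_self.mp hR.nonneg
  exact ⟨B, by rwa [star_eq_conjTranspose, conjTranspose_eq_transpose_of_trivial] at hB⟩

lemma dotProduct_self_nonneg_real {ι : Type*} [Fintype ι] (x : ι → ℝ) : 0 ≤ x ⬝ᵥ x :=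
  Finset.sum_nonneg fun i _ => mul_self_nonneg (x i)

lemma dotProduct_sq_le {ι : Type*} [Fintype ι] (x y : ι → ℝ) :
    (x ⬝ᵥ y) ^ 2 ≤ (x ⬝ᵥ x) * (y ⬝ᵥ y) := by
  simpa only [dotProduct, sq] using Finset.sum_mul_sq_le_sq_mul_sq Finset.univ x y

lemma posDef_of_le_dotProduct_mulVec {ι : Type*} [Fintype ι] {A : Matrix ι ι ℝ} (hA : A.IsHermitian) {c : ℝ} (hc : 0 < c)
    (h : ∀ x, c * (x ⬝ᵥ x) ≤ x ⬝ᵥ A *ᵥ x) : A.PosDef := by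
  refine PosDef.of_dotProduct_mulVec_pos hA fun x hx => ?_
  have : 0 < x ⬝ᵥ x := by
    rw [← star_trivial x]
    simpa using dotProduct_star_self_pos_iff.2 hx
  rw [star_trivial]
  exact (mul_pos hc this).trans_le (h x)

/-- If `QᵀQ ≤ C` then `QQᵀ ≤ C`. -/
lemma dotProduct_transpose_mulVec_le {ι : Type*} [Fintype ι] {Q : Matrix ι ι ℝ} {C : ℝ}
    (h : ∀ x, x ⬝ᵥ (Qᵀ * Q) *ᵥ x ≤ C * (x ⬝ᵥ x)) (x : ι → ℝ) :
    (Qᵀ *ᵥ x) ⬝ᵥ (Qᵀ *ᵥ x) ≤ C * (x ⬝ᵥ x) := by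
  set u := Qᵀ *ᵥ x
  have h1 : u ⬝ᵥ u = x ⬝ᵥ Q *ᵥ u := by
    rw [dotProduct_mulVec x, ← mulVec_transpose]
  have h2 : (Q *ᵥ u) ⬝ᵥ (Q *ᵥ u) ≤ C * (u ⬝ᵥ u) := by
    refine le_trans (le_of_eq ?_) (h u)
    rw [← mulVec_mulVec, dotProduct_mulVec u, vecMul_transpose]
  have h3 := dotProduct_sq_le x (Q *ᵥ u)
  rw [← h1] at h3
  have h4 : (u ⬝ᵥ u) ^ 2 ≤ (x ⬝ᵥ x) * (C * (u ⬝ᵥ u)) :=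
    h3.trans (mul_le_mul_of_nonneg_left h2 (dotProduct_self_nonneg_real x))
  rcases (dotProduct_self_nonneg_real u).eq_or_lt with h0 | h0
  · rw [← h0]
    have hC : 0 ≤ C * (x ⬝ᵥ x) :=
      le_trans (by
        rw [← mulVec_mulVec, dotProduct_mulVec x, vecMul_transpose]
        exact dotProduct_self_nonneg_real _) (h x)
    exact hC
  · nlinarith

/-- A matrix bounded below has an inverse that is bounded above. -/
lemma sq_mul_dotProduct_inv_mulVec_le {ι : Type*} [Fintype ι] [DecidableEq ι]
    {A : Matrix ι ι ℝ} {c : ℝ} (hA : IsUnit A.det) (hc : 0 < c)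
    (h : ∀ x, c * (x ⬝ᵥ x) ≤ x ⬝ᵥ A *ᵥ x) (x : ι → ℝ) :
    c ^ 2 * ((A⁻¹ *ᵥ x) ⬝ᵥ (A⁻¹ *ᵥ x)) ≤ x ⬝ᵥ x := by
  set u := A⁻¹ *ᵥ x
  have h1 := h u
  rw [show A *ᵥ u = x by rw [mulVec_mulVec, mul_nonsing_inv _ hA, one_mulVec]] at h1
  have h2 := dotProduct_sq_le u x
  rcases (dotProduct_self_nonneg_real u).eq_or_lt with h0 | h0
  · rw [← h0, mul_zero]
    exact dotProduct_self_nonneg_real x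
  · have h3 : (c * (u ⬝ᵥ u)) ^ 2 ≤ (u ⬝ᵥ u) * (x ⬝ᵥ x) :=
      le_trans (pow_le_pow_left₀ (by positivity) h1 2) h2
    nlinarith

/-- Schur's test: 2|xᵢxⱼ| ≤ xᵢ² + xⱼ², and symmetry merges the two halves. -/
lemma sum_abs_mul_mul_le {ι : Type*} [Fintype ι] {R : Matrix ι ι ℝ} {C : ℝ} (hR : R.IsSymm)
    (hC : ∀ i, ∑ j, |R i j| ≤ C) (x : ι → ℝ) : |x ⬝ᵥ R *ᵥ x| ≤ C * (x ⬝ᵥ x) := by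
  have h1 : |x ⬝ᵥ R *ᵥ x| ≤ ∑ i, ∑ j, |R i j| * (x i ^ 2 + x j ^ 2) / 2 := by
    simp only [dotProduct, mulVec]
    refine (Finset.abs_sum_le_sum_abs _ _).trans (Finset.sum_le_sum fun i _ => ?_)
    rw [Finset.mul_sum]
    refine (Finset.abs_sum_le_sum_abs _ _).trans (Finset.sum_le_sum fun j _ => ?_)
    rw [show x i * (R i j * x j) = R i j * (x i * x j) by ring, abs_mul, mul_div_assoc]
    refine mul_le_mul_of_nonneg_left ?_ (abs_nonneg _)
    rw [abs_le]
    constructor <;> nlinarith [sq_nonneg (x i + x j), sq_nonneg (x i - x j)]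
  have h2 : ∑ i, ∑ j, |R i j| * (x i ^ 2 + x j ^ 2) / 2 = ∑ i, (∑ j, |R i j|) * x i ^ 2 := by
    have h3 : ∑ i, ∑ j, |R i j| * x j ^ 2 = ∑ i, ∑ j, |R i j| * x i ^ 2 := by
      rw [Finset.sum_comm]
      refine Finset.sum_congr rfl fun i _ => Finset.sum_congr rfl fun j _ => ?_
      rw [hR.apply]
    simp_rw [mul_add, add_div, Finset.sum_add_distrib, ← Finset.sum_div]
    rw [h3]
    simp_rw [Finset.sum_mul]
    ring
  rw [h2] at h1
  refine h1.trans ?_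
  rw [dotProduct, Finset.mul_sum]
  refine Finset.sum_le_sum fun i _ => ?_
  rw [← sq]
  exact mul_le_mul_of_nonneg_right (hC i) (sq_nonneg _)

/-- Cauchy-Schwarz in each row with weights |D i j|. The bound is linear in these weights, so
control of the total mass of a bracket will suffice. -/
lemma dotProduct_mulVec_self_le {ι : Type*} [Fintype ι] {D : Matrix ι ι ℝ} {C : ℝ}
    (hC : ∀ i, ∑ j, |D i j| ≤ C) (z : ι → ℝ) :
    (D *ᵥ z) ⬝ᵥ (D *ᵥ z) ≤ C * ∑ i, ∑ j, |D i j| * z j ^ 2 := by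
  rw [dotProduct, Finset.mul_sum]
  refine Finset.sum_le_sum fun i _ => ?_
  rw [← sq]
  have h0 : 0 ≤ ∑ j, |D i j| * z j ^ 2 := Finset.sum_nonneg fun j _ => by positivity
  refine le_trans ?_ (mul_le_mul_of_nonneg_right (hC i) h0)
  simp only [mulVec, dotProduct]
  refine Finset.sum_sq_le_sum_mul_sum_of_sq_le_mul _ (fun j _ => abs_nonneg _)
    (fun j _ => by positivity) fun j _ => ?_
  rw [mul_pow, ← mul_assoc, ← sq, sq_abs]

/-- With R = BᵀB, each trace is the sum of the form over the rows of B. This passes from bounds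
valid for every sample to bounds on the means. -/
lemma trace_mul_le_trace_mul {ι : Type*} [Fintype ι] [DecidableEq ι] {M N R : Matrix ι ι ℝ}
    (hR : R.PosSemidef) (h : ∀ x, x ⬝ᵥ M *ᵥ x ≤ x ⬝ᵥ N *ᵥ x) :
    (M * R).trace ≤ (N * R).trace := by
  obtain ⟨B, rfl⟩ := exists_eq_transpose_mul_self hR
  have key : ∀ X : Matrix ι ι ℝ, (X * (Bᵀ * B)).trace = ∑ k, B k ⬝ᵥ X *ᵥ B k := by
    intro X
    rw [← Matrix.mul_assoc, trace_mul_comm, trace]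
    refine Finset.sum_congr rfl fun k => ?_
    intro _
    simp only [diag_apply, mul_apply, dotProduct, mulVec, transpose_apply]
  rw [key, key]
  exact Finset.sum_le_sum fun k _ => h _

/-! ### Diagonalization and the Kullback-Leibler bound -/

section Diagonalization

variable {ι : Type*} [Fintype ι] [DecidableEq ι]

lemma exists_orthogonal_diagonalization {A : Matrix ι ι ℝ} (hA : A.IsHermitian) :
    ∃ (Q : Matrix ι ι ℝ) (d : ι → ℝ), Qᵀ * Q = 1 ∧ Q * A * Qᵀ = diagonal d ∧
      ∀ i, Module.End.HasEigenvalue (toLin' A) (d i) := by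
  refine ⟨star (hA.eigenvectorUnitary : Matrix ι ι ℝ), hA.eigenvalues, ?_, ?_, fun i => ?_⟩
  · rw [star_eq_conjTranspose, conjTranspose_eq_transpose_of_trivial, transpose_transpose]
    simpa [star_eq_conjTranspose] using Unitary.mul_star_self_of_mem hA.eigenvectorUnitary.2
  · have := hA.conjStarAlgAut_star_eigenvectorUnitary
    rw [Unitary.conjStarAlgAut_apply] at this
    simpa [star_eq_conjTranspose] using this
  · rw [Module.End.hasEigenvalue_iff_mem_spectrum, spectrum_toLin']
    exact hA.eigenvalues_mem_spectrum_real i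

/-- Simultaneous diagonalization by congruence. -/
lemma exists_simultaneous_diagonalization {R M : Matrix ι ι ℝ} (hR : R.PosDef)
    (hM : M.IsHermitian) :
    ∃ (Q : Matrix ι ι ℝ) (d : ι → ℝ), IsUnit Q ∧ R = Qᵀ * Q ∧ Q * M * Qᵀ = diagonal d := by
  obtain ⟨B, hB⟩ := exists_eq_transpose_mul_self hR.posSemidef
  have hBM : (B * M * Bᵀ).IsHermitian := by
    have := isHermitian_mul_mul_conjTranspose B hM
    rwa [conjTranspose_eq_transpose_of_trivial] at this
  obtain ⟨U, d, hU, hd, -⟩ := exists_orthogonal_diagonalization hBM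
  have hRQ : R = (U * B)ᵀ * (U * B) := by
    rw [transpose_mul, Matrix.mul_assoc, ← Matrix.mul_assoc Uᵀ, hU, Matrix.one_mul, hB]
  refine ⟨U * B, d, ?_, hRQ, ?_⟩
  · have := hR.isUnit
    rw [hRQ] at this
    exact isUnit_of_mul_isUnit_right this
  · rw [← hd, transpose_mul]
    simp only [Matrix.mul_assoc]

lemma le_dotProduct_mulVec_of_hasEigenvalue {A : Matrix ι ι ℝ} (hA : A.IsHermitian) {c : ℝ}
    (h : ∀ r, Module.End.HasEigenvalue (toLin' A) r → c ≤ r) (x : ι → ℝ) :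
    c * (x ⬝ᵥ x) ≤ x ⬝ᵥ A *ᵥ x := by
  obtain ⟨Q, d, hQ, hd, he⟩ := exists_orthogonal_diagonalization hA
  have hA' : A = Qᵀ * diagonal d * Q := by
    rw [← hd]
    calc A = (Qᵀ * Q) * A * (Qᵀ * Q) := by rw [hQ]; simp
      _ = _ := by simp only [Matrix.mul_assoc]
  have h1 : x ⬝ᵥ x = (Q *ᵥ x) ⬝ᵥ (Q *ᵥ x) := by
    rw [dotProduct_mulVec, ← mulVec_transpose, mulVec_mulVec, hQ, one_mulVec]
  have h2 : x ⬝ᵥ A *ᵥ x = (Q *ᵥ x) ⬝ᵥ (diagonal d *ᵥ (Q *ᵥ x)) := by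
    rw [hA', ← mulVec_mulVec, ← mulVec_mulVec, dotProduct_mulVec, vecMul_transpose]
  rw [h1, h2, dotProduct, dotProduct, Finset.mul_sum]
  refine Finset.sum_le_sum fun i _ => ?_
  rw [mulVec_diagonal]
  nlinarith [h _ (he i), mul_self_nonneg ((Q *ᵥ x) i)]

/-- Simultaneous diagonalization of two quadratic forms. -/
lemma exists_simultaneous_diagonalization_forms {R A : Matrix ι ι ℝ} (hR : R.PosDef)
    (hA : A.IsHermitian) :
    ∃ (Q : Matrix ι ι ℝ) (e : ι → ℝ), IsUnit Q ∧ R = Qᵀ * Q ∧ A = Qᵀ * diagonal e * Q := by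
  have hdet : IsUnit R.det := (isUnit_iff_isUnit_det R).1 hR.isUnit
  have hM : (R⁻¹ * A * R⁻¹).IsHermitian := by
    have := isHermitian_mul_mul_conjTranspose R⁻¹ hA
    rwa [hR.isHermitian.inv.eq] at this
  obtain ⟨Q, e, hQ, hRQ, hd⟩ := exists_simultaneous_diagonalization hR hM
  refine ⟨Q, e, hQ, hRQ, ?_⟩
  calc A = (R * R⁻¹) * A * (R⁻¹ * R) := by rw [mul_nonsing_inv _ hdet, nonsing_inv_mul _ hdet]; simp
    _ = (Qᵀ * Q) * (R⁻¹ * A * R⁻¹) * (Qᵀ * Q) := by rw [← hRQ]; simp only [Matrix.mul_assoc]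
    _ = Qᵀ * (Q * (R⁻¹ * A * R⁻¹) * Qᵀ) * Q := by simp only [Matrix.mul_assoc]
    _ = _ := by rw [hd]

/-- For e = s², the inequality log s ≥ 1 − 1/s bounds the right side below by (1/s − 1)², while (e −
1)² = (1/s − 1)² e (s + 1)². -/
lemma sub_one_sq_le_log_add_inv {e Λ : ℝ} (he : 0 < e) (heΛ : e ≤ Λ) :
    (e - 1) ^ 2 / (Λ * (2 * Λ + 2)) ≤ Real.log e + e⁻¹ - 1 := by
  obtain ⟨s, hs, rfl⟩ : ∃ s : ℝ, 0 < s ∧ e = s ^ 2 :=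
    ⟨Real.sqrt e, Real.sqrt_pos.2 he, (Real.sq_sqrt he.le).symm⟩
  have hlog : 1 - s⁻¹ ≤ Real.log s := Real.one_sub_inv_le_log_of_pos hs
  have h1 : (s⁻¹ - 1) ^ 2 ≤ Real.log (s ^ 2) + (s ^ 2)⁻¹ - 1 := by
    rw [Real.log_pow, ← inv_pow]
    push_cast
    nlinarith
  refine le_trans ?_ h1
  have hΛ : 0 < Λ := he.trans_le heΛ
  rw [div_le_iff₀ (by positivity)]
  have h2 : (s ^ 2 - 1) ^ 2 = (s⁻¹ - 1) ^ 2 * (s ^ 2 * (s + 1) ^ 2) := by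
    field_simp
    ring
  rw [h2]
  refine mul_le_mul_of_nonneg_left ?_ (sq_nonneg _)
  refine mul_le_mul heΛ ?_ (sq_nonneg _) hΛ.le
  nlinarith [sq_nonneg (s - 1)]

/-- The Kullback-Leibler divergence of centered Gaussian vectors controls the Frobenius distance
of their covariance matrices. -/
lemma frobenius_le_kullbackLeibler {R A : Matrix ι ι ℝ} (hR : R.IsHermitian) (hA : A.IsHermitian)
    {c C : ℝ} (hc : 0 < c) (hC : 0 < C)
    (hcR : ∀ x, c * (x ⬝ᵥ x) ≤ x ⬝ᵥ R *ᵥ x) (hCR : ∀ x, x ⬝ᵥ R *ᵥ x ≤ C * (x ⬝ᵥ x))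
    (hcA : ∀ x, c * (x ⬝ᵥ x) ≤ x ⬝ᵥ A *ᵥ x) (hCA : ∀ x, x ⬝ᵥ A *ᵥ x ≤ C * (x ⬝ᵥ x)) :
    (∑ i, ∑ j, (A i j - R i j) ^ 2) / (C ^ 2 * (C / c * (2 * (C / c) + 2))) ≤
      Real.log A.det - Real.log R.det + (A⁻¹ * R).trace - Fintype.card ι := by
  have hRpos := posDef_of_le_dotProduct_mulVec hR hc hcR
  have hApos := posDef_of_le_dotProduct_mulVec hA hc hcA
  obtain ⟨Q, e, hQ, hRQ, hAQ⟩ := exists_simultaneous_diagonalization_forms hRpos hA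
  have hQdet : IsUnit Q.det := (isUnit_iff_isUnit_det Q).1 hQ
  -- The `e i` are the eigenvalues of `A` relative to `R`, so they are ratios of two forms with
  -- values between c|x|² and C|x|².
  have hbound : ∀ i, 0 < e i ∧ e i ≤ C / c := by
    intro i
    set x := Q⁻¹ *ᵥ Pi.single i 1
    have hx : Q *ᵥ x = Pi.single i 1 := by
      rw [mulVec_mulVec, mul_nonsing_inv _ hQdet, one_mulVec]
    have h1 : x ⬝ᵥ R *ᵥ x = 1 := by
      rw [hRQ, ← mulVec_mulVec, dotProduct_mulVec x, vecMul_transpose, hx]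
      simp
    have h2 : x ⬝ᵥ A *ᵥ x = e i := by
      rw [hAQ, ← mulVec_mulVec, ← mulVec_mulVec, dotProduct_mulVec x, vecMul_transpose, hx]
      simp
    have h3 := hcR x
    have h4 := hCR x
    have h5 := hcA x
    have h6 := hCA x
    rw [h1] at h3 h4
    rw [h2] at h5 h6
    have hx0 : 0 < x ⬝ᵥ x := pos_of_mul_pos_right (by linarith) hC.le
    refine ⟨(mul_pos hc hx0).trans_le h5, ?_⟩
    rw [le_div_iff₀ hc]
    nlinarith
  have hne : ∀ i, e i ≠ 0 := fun i => (hbound i).1.ne'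
  have hdet : Real.log A.det - Real.log R.det = ∑ i, Real.log (e i) := by
    rw [hAQ, hRQ, det_mul, det_mul, det_mul, det_transpose, det_diagonal,
      mul_comm Q.det, mul_assoc, Real.log_mul (Finset.prod_ne_zero_iff.2 fun i _ => hne i)
        (mul_self_ne_zero.2 hQdet.ne_zero), Real.log_prod (fun i _ => hne i)]
    ring
  have htrace : (A⁻¹ * R).trace = ∑ i, (e i)⁻¹ := by
    have hX : A * (Q⁻¹ * diagonal (fun i => (e i)⁻¹) * Q) = R := by
      rw [hAQ, hRQ]
      calc Qᵀ * diagonal e * Q * (Q⁻¹ * diagonal (fun i => (e i)⁻¹) * Q)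
          = Qᵀ * diagonal e * (Q * Q⁻¹) * diagonal (fun i => (e i)⁻¹) * Q := by
            simp only [Matrix.mul_assoc]
        _ = Qᵀ * (diagonal e * diagonal (fun i => (e i)⁻¹)) * Q := by
            rw [mul_nonsing_inv _ hQdet]
            simp only [Matrix.mul_assoc, Matrix.one_mul]
        _ = Qᵀ * Q := by
            rw [diagonal_mul_diagonal]
            simp [hne]
    rw [← hX, ← Matrix.mul_assoc, nonsing_inv_mul _ ((isUnit_iff_isUnit_det A).1 hApos.isUnit),
      Matrix.one_mul, trace_mul_comm, ← Matrix.mul_assoc, mul_nonsing_inv _ hQdet, Matrix.one_mul,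
      trace_diagonal]
  have hQC := dotProduct_transpose_mulVec_le (Q := Q) (C := C) (by rwa [← hRQ])
  have hrow : ∀ k, ∑ j, Q k j ^ 2 ≤ C := by
    intro k
    have := hQC (Pi.single k 1)
    simpa [dotProduct, sq, Pi.single_apply] using this
  -- A − R = Qᵀ diag(e − 1) Q. One factor `C` comes from the outer Qᵀ, the other from the row norms
  -- of Q.
  have hfrob : ∑ i, ∑ j, (A i j - R i j) ^ 2 ≤ C ^ 2 * ∑ k, (e k - 1) ^ 2 := by
    have hcol : ∀ j, ∑ i, (A i j - R i j) ^ 2 ≤ C * ∑ k, ((e k - 1) * Q k j) ^ 2 := by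
      intro j
      have h1 := hQC fun k => (e k - 1) * Q k j
      have h2 : ∀ i, (Qᵀ *ᵥ fun k => (e k - 1) * Q k j) i = A i j - R i j := by
        intro i
        rw [hAQ, hRQ, mul_apply, mul_apply]
        simp only [mulVec, dotProduct, mul_diagonal, transpose_apply, ← Finset.sum_sub_distrib]
        exact Finset.sum_congr rfl fun k _ => by ring
      simpa only [dotProduct, h2, ← sq] using h1
    rw [Finset.sum_comm]
    refine (Finset.sum_le_sum fun j _ => hcol j).trans ?_
    rw [← Finset.mul_sum, Finset.sum_comm, sq C, mul_assoc]
    refine mul_le_mul_of_nonneg_left ?_ hC.le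
    rw [Finset.mul_sum]
    refine Finset.sum_le_sum fun k _ => ?_
    simp_rw [mul_pow]
    rw [← Finset.mul_sum, mul_comm]
    exact mul_le_mul_of_nonneg_right (hrow k) (sq_nonneg _)
  rw [hdet, htrace]
  have hsum : ∑ i, (e i - 1) ^ 2 / (C / c * (2 * (C / c) + 2)) ≤
      ∑ i, (Real.log (e i) + (e i)⁻¹ - 1) :=
    Finset.sum_le_sum fun i _ => sub_one_sq_le_log_add_inv (hbound i).1 (hbound i).2
  rw [← Finset.sum_div, Finset.sum_sub_distrib, Finset.sum_add_distrib] at hsum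
  simp only [Finset.sum_const, Finset.card_univ, nsmul_eq_mul, mul_one] at hsum
  refine le_trans ?_ hsum
  rw [← div_div]
  refine div_le_div_of_nonneg_right ?_ (by positivity)
  rwa [div_le_iff₀' (by positivity)]

end Diagonalization

/-! ### Quadratic forms of Gaussian vectors -/

section QuadraticForms

variable {Ω ι : Type*} [MeasurableSpace Ω] [Fintype ι]

/-- The variance of the square of a standard Gaussian variable. -/
def varSqGaussian : ℝ := Var[fun x : ℝ => x ^ 2; gaussianReal 0 1]

lemma IsCenteredGaussianProcess.hasGaussianLaw {E : Type*} {P : Measure Ω} {Y : E → Ω → ℝ}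
    {k : E → E → ℝ} (hY : IsCenteredGaussianProcess Y k P) (x : ι → E) :
    HasGaussianLaw (fun ω i => Y (x i) ω) P := by
  classical
  -- The points may repeat, so the marginal is taken over their finite image and pulled back.
  have h := (hY.1.hasGaussianLaw (Finset.univ.image x)).map
    (ContinuousLinearMap.pi fun i => ContinuousLinearMap.proj (R := ℝ)
      (φ := fun _ : Finset.univ.image x => ℝ)
      ⟨x i, Finset.mem_image_of_mem _ (Finset.mem_univ i)⟩)
  exact h

variable [DecidableEq ι] {P : Measure Ω} {y : ι → Ω → ℝ} {R M : Matrix ι ι ℝ}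

/-- Moments of a quadratic form of a centered Gaussian vector. -/
lemma quadraticForm_moments (hy : HasGaussianLaw (fun ω i => y i ω) P)
    (hy0 : ∀ i, ∫ ω, y i ω ∂P = 0) (hcov : ∀ i j, cov[y i, y j; P] = R i j) (hR : R.PosDef)
    (hM : M.IsHermitian) {C m : ℝ} (hm : 0 ≤ m)
    (hCR : ∀ x, x ⬝ᵥ R *ᵥ x ≤ C * (x ⬝ᵥ x)) (hMm : ∀ x, |x ⬝ᵥ M *ᵥ x| ≤ m * (x ⬝ᵥ x)) :
    MemLp (fun ω => (fun i => y i ω) ⬝ᵥ M *ᵥ (fun i => y i ω)) 2 P ∧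
    ∫ ω, (fun i => y i ω) ⬝ᵥ M *ᵥ (fun i => y i ω) ∂P = (M * R).trace ∧
    Var[fun ω => (fun i => y i ω) ⬝ᵥ M *ᵥ (fun i => y i ω); P] ≤
      varSqGaussian * (m * C) ^ 2 * Fintype.card ι := by
  have hP := hy.isProbabilityMeasure
  -- Whitening by (Qᵀ)⁻¹ turns the form into Σ dᵢgᵢ² with independent standard Gaussian gᵢ; hence
  -- the mean Σ dᵢ and a variance proportional to Σ dᵢ².
  obtain ⟨Q, d, hQ, hRQ, hd⟩ := exists_simultaneous_diagonalization hR hM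
  have hQdet : IsUnit Q.det := (isUnit_iff_isUnit_det Q).1 hQ
  have hQTdet : IsUnit (Qᵀ).det := by rwa [det_transpose]
  set W : Matrix ι ι ℝ := (Qᵀ)⁻¹ with hW
  have hdle : ∀ i, |d i| ≤ m * C := by
    intro i
    have h1 := hMm (Qᵀ *ᵥ Pi.single i 1)
    have h2 := dotProduct_transpose_mulVec_le (Q := Q) (C := C) (by rwa [← hRQ]) (Pi.single i 1)
    have h3 : (Qᵀ *ᵥ Pi.single i 1) ⬝ᵥ M *ᵥ (Qᵀ *ᵥ Pi.single i 1) = d i := by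
      rw [mulVec_mulVec, mulVec_transpose, ← dotProduct_mulVec, mulVec_mulVec,
        ← Matrix.mul_assoc, hd]
      simp
    rw [h3] at h1
    refine h1.trans (mul_le_mul_of_nonneg_left ?_ hm)
    simpa using h2
  -- the whitened vector
  let g : ι → Ω → ℝ := fun i ω => ∑ j, W i j * y j ω
  have hg : HasGaussianLaw (fun ω i => g i ω) P :=
    hy.map (LinearMap.toContinuousLinearMap (toLin' W))
  have hyL : ∀ i, MemLp (y i) 2 P := fun i => (hy.eval i).memLp_two
  have hgL : ∀ i, MemLp (g i) 2 P := fun i => (hg.eval i).memLp_two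
  have hg0 : ∀ i, ∫ ω, g i ω ∂P = 0 := by
    intro i
    rw [integral_finsetSum _ fun j _ => ((hyL j).integrable (by norm_num)).const_mul _]
    simp [integral_const_mul, hy0]
  have hgcov : ∀ i j, cov[g i, g j; P] = (1 : Matrix ι ι ℝ) i j := by
    intro i j
    have h1 : W * R * Wᵀ = 1 := by
      rw [hRQ, hW, ← Matrix.mul_assoc, nonsing_inv_mul _ hQTdet, Matrix.one_mul,
        ← transpose_nonsing_inv, transpose_transpose, mul_nonsing_inv _ hQdet]
    rw [← h1]
    simp only [g]
    rw [covariance_fun_sum_fun_sum (fun k => (hyL k).const_mul _) (fun k => (hyL k).const_mul _)]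
    simp only [covariance_const_mul_left, covariance_const_mul_right, hcov, mul_apply,
      transpose_apply, Finset.sum_mul]
    rw [Finset.sum_comm]
    exact Finset.sum_congr rfl fun _ _ => Finset.sum_congr rfl fun _ _ => by ring
  have hindep : iIndepFun g P :=
    hg.iIndepFun_of_covariance_eq_zero fun i j hij => by rw [hgcov, one_apply_ne hij]
  have hvar : ∀ i, Var[g i; P] = 1 := fun i => by
    rw [← covariance_self (hgL i).aemeasurable, hgcov, one_apply_eq]
  have hlaw : ∀ i, P.map (g i) = gaussianReal 0 1 := fun i => by
    rw [(hg.eval i).map_eq_gaussianReal]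
    simp [hg0, hvar]
  have hsqL : ∀ i, MemLp (fun ω => g i ω ^ 2) 2 P := by
    intro i
    have h4 : MemLp (g i) 4 P := (hg.eval i).memLp (by norm_num)
    have := h4.norm_rpow_div 2
    norm_num at this
    have h2 : (4 / 2 : ENNReal) = 2 := by
      rw [show (4 : ENNReal) = 2 * 2 by norm_num, ENNReal.div_eq_inv_mul, ← mul_assoc,
        ENNReal.inv_mul_cancel (by norm_num) (by norm_num), one_mul]
    rw [h2] at this
    exact this
  have hsqI : ∀ i, ∫ ω, g i ω ^ 2 ∂P = 1 := by
    intro i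
    rw [← hvar i, variance_of_integral_eq_zero (hgL i).aemeasurable (hg0 i)]
  have hsqV : ∀ i, Var[fun ω => g i ω ^ 2; P] = varSqGaussian := by
    intro i
    rw [varSqGaussian, ← hlaw i, variance_map (by fun_prop) (hgL i).aemeasurable]
    rfl
  have hform : ∀ ω, (fun i => y i ω) ⬝ᵥ M *ᵥ (fun i => y i ω) = ∑ i, d i * g i ω ^ 2 := by
    intro ω
    have h1 : (fun i => y i ω) = Qᵀ *ᵥ (fun i => g i ω) := by
      have : (fun i => g i ω) = W *ᵥ (fun i => y i ω) := rfl
      rw [this, mulVec_mulVec, mul_nonsing_inv _ hQTdet, one_mulVec]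
    rw [h1, mulVec_mulVec, mulVec_transpose Q, ← dotProduct_mulVec, mulVec_mulVec,
      ← Matrix.mul_assoc, hd]
    simp only [dotProduct, mulVec_diagonal]
    exact Finset.sum_congr rfl fun i _ => by ring
  simp_rw [hform]
  refine ⟨memLp_finsetSum _ fun i _ => (hsqL i).const_mul _, ?_, ?_⟩
  · rw [integral_finsetSum _ fun i _ => ((hsqL i).const_mul _).integrable (by norm_num)]
    simp only [integral_const_mul, hsqI, mul_one]
    rw [hRQ, ← Matrix.mul_assoc, trace_mul_comm, ← Matrix.mul_assoc, hd, trace_diagonal]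
  · rw [variance_fun_sum fun i => (hsqL i).const_mul _]
    have : ∀ i j, cov[fun ω => d i * g i ω ^ 2, fun ω => d j * g j ω ^ 2; P] =
        if i = j then d i ^ 2 * varSqGaussian else 0 := by
      intro i j
      split_ifs with hij
      · subst hij
        rw [covariance_self (((hsqL i).const_mul _).aemeasurable), variance_const_mul, hsqV]
      · rw [covariance_const_mul_left, covariance_const_mul_right]
        have hij' := (hindep.indepFun hij).comp (φ := fun x => x ^ 2) (ψ := fun x => x ^ 2)
          (by fun_prop) (by fun_prop)
        have h0 : cov[fun ω => g i ω ^ 2, fun ω => g j ω ^ 2; P] = 0 :=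
          hij'.covariance_eq_zero (hsqL i) (hsqL j)
        rw [h0]
        simp
    simp_rw [this]
    simp only [Finset.sum_ite_eq, Finset.mem_univ, if_true]
    rw [← Finset.sum_mul, mul_assoc, mul_comm]
    refine mul_le_mul_of_nonneg_left ?_ (variance_nonneg _ _)
    refine (Finset.sum_le_card_nsmul _ _ ((m * C) ^ 2) fun i _ => ?_).trans ?_
    · rw [← sq_abs]
      exact pow_le_pow_left₀ (abs_nonneg _) (hdle i) 2
    · rw [nsmul_eq_mul, Finset.card_univ, mul_comm]

/-- Concentration of a quadratic form of a centered Gaussian vector. -/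
lemma measure_quadraticForm_le [IsProbabilityMeasure P] (hy : HasGaussianLaw (fun ω i => y i ω) P)
    (hy0 : ∀ i, ∫ ω, y i ω ∂P = 0) (hcov : ∀ i j, cov[y i, y j; P] = R i j) (hR : R.PosDef)
    (hM : M.IsHermitian) {C m ε : ℝ} (hm : 0 ≤ m) (hε : 0 < ε)
    (hCR : ∀ x, x ⬝ᵥ R *ᵥ x ≤ C * (x ⬝ᵥ x)) (hMm : ∀ x, |x ⬝ᵥ M *ᵥ x| ≤ m * (x ⬝ᵥ x)) :
    P {ω | ε ≤ |(fun i => y i ω) ⬝ᵥ M *ᵥ (fun i => y i ω) - (M * R).trace|} ≤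
      ENNReal.ofReal (varSqGaussian * (m * C) ^ 2 * Fintype.card ι / ε ^ 2) := by
  obtain ⟨h1, h2, h3⟩ := quadraticForm_moments hy hy0 hcov hR hM hm hCR hMm
  rw [← h2]
  refine (meas_ge_le_variance_div_sq h1 hε).trans (ENNReal.ofReal_le_ofReal ?_)
  exact div_le_div_of_nonneg_right h3 (sq_nonneg _)

end QuadraticForms

/-! ### Bracketing of monotone functions -/

section Covering

/-- The part of the plane on which the members of a chain of sets with nearly equal
cardinalities disagree is small. -/
lemma card_chain_disagreement_le {I α : Type*} [Fintype α] [DecidableEq α] {T : Set I}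
    {S : I → Finset α} {a m : ℕ}
    (hchain : ∀ i ∈ T, ∀ j ∈ T, S i ⊆ S j ∨ S j ⊆ S i)
    (hcard : ∀ i ∈ T, a ≤ (S i).card ∧ (S i).card ≤ a + m) (V : Finset α)
    (hV : ∀ p ∈ V, (∃ i ∈ T, p ∈ S i) ∧ ∃ j ∈ T, p ∉ S j) : V.card ≤ m := by
  rcases T.eq_empty_or_nonempty with rfl | hT
  · have : V = ∅ := Finset.eq_empty_of_forall_notMem fun p hp => by simpa using (hV p hp).1
    simp [this]
  have hfin : (S '' T).Finite := Set.toFinite _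
  -- The largest and smallest members of the chain enclose all the others, so disagreement occurs
  -- only in their difference.
  obtain ⟨_, ⟨i, hi, rfl⟩, hmax⟩ := Set.exists_max_image (S '' T) Finset.card hfin (hT.image S)
  obtain ⟨_, ⟨j, hj, rfl⟩, hmin⟩ := Set.exists_min_image (S '' T) Finset.card hfin (hT.image S)
  have hsub : ∀ k ∈ T, S k ⊆ S i ∧ S j ⊆ S k := by
    intro k hk
    constructor
    · rcases hchain k hk i hi with h | h
      · exact h
      · exact (Finset.eq_of_subset_of_card_le h (hmax _ ⟨k, hk, rfl⟩)).symm.subset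
    · rcases hchain k hk j hj with h | h
      · exact (Finset.eq_of_subset_of_card_le h (hmin _ ⟨k, hk, rfl⟩)).symm.subset
      · exact h
  have hVsub : V ⊆ S i \ S j := by
    intro p hp
    obtain ⟨⟨k, hk, hpk⟩, l, hl, hpl⟩ := hV p hp
    exact Finset.mem_sdiff.2 ⟨(hsub k hk).1 hpk, fun h => hpl ((hsub l hl).2 h)⟩
  refine (Finset.card_le_card hVsub).trans ?_
  rw [Finset.card_sdiff_of_subset (hsub i hi).2]
  have := (hcard i hi).2
  have := (hcard j hj).1
  omega

/-- A discrete layer-cake formula: counting the integer levels reached recovers `x` up to a rounding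
error below 1. -/
lemma sum_levels {x : ℝ} {K : ℕ} (hx : 0 ≤ x) (hxK : x ≤ K) :
    (∑ k : Fin K, if ((k : ℕ) : ℝ) + 1 ≤ x then (1 : ℝ) else 0) = ⌊x⌋₊ := by
  rw [Fin.sum_univ_eq_sum_range (fun k : ℕ => if (k : ℝ) + 1 ≤ x then (1 : ℝ) else 0),
    Finset.sum_boole]
  congr 1
  rw [show (Finset.range K).filter (fun k : ℕ => (k : ℝ) + 1 ≤ x) = Finset.range ⌊x⌋₊ from ?_,
    Finset.card_range]
  ext k
  have h1 : (k : ℝ) + 1 ≤ x ↔ k + 1 ≤ ⌊x⌋₊ := by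
    rw [Nat.le_floor_iff hx]
    push_cast
    rfl
  have h2 : ⌊x⌋₊ ≤ K := Nat.floor_le_of_le hxK
  simp only [Finset.mem_filter, Finset.mem_range, h1]
  omega

/-- A finite bracketing of a family of bounded functions that are nonincreasing in `W`. The number
of brackets depends only on `K` and `N`. -/
lemma exists_bracketing_antitone {I α : Type*} [Fintype α] [DecidableEq α] (T : Set I)
    (U : Finset α) (W : α → ℝ) (f : I → α → ℝ) {A : ℝ} (hA : 0 < A)
    (hf : ∀ i ∈ T, ∀ p, 0 ≤ f i p ∧ f i p ≤ A)
    (hanti : ∀ i ∈ T, ∀ p q, W p ≤ W q → f i q ≤ f i p)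
    {K m N : ℕ} (hK : 0 < K) (hm : 0 < m) (hN : U.card ≤ N * m) :
    ∃ cl : I → Fin K → Fin (N + 1), ∀ v, ∃ B : α → ℝ, (∀ p, 0 ≤ B p) ∧
      (∀ i ∈ T, ∀ j ∈ T, cl i = v → cl j = v → ∀ p ∈ U, |f i p - f j p| ≤ B p) ∧
      ∑ p ∈ U, B p ≤ A * (U.card / K + m) := by
  classical
  have hK' : (0 : ℝ) < K := by exact_mod_cast hK
  set δ := A / K with hδ
  have hδ0 : 0 < δ := by positivity
  let S : Fin K → I → Finset α := fun k i => U.filter fun p => ((k : ℕ) : ℝ) + 1 ≤ f i p / δ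
  have hSN : ∀ k i, (S k i).card / m ≤ N := fun k i =>
    Nat.div_le_of_le_mul ((Finset.card_filter_le _ _).trans (by rwa [mul_comm]))
  -- The class records the cardinality of each superlevel set in units of `m`. Monotonicity in `W`
  -- makes these sets a chain, so within a class each level disagrees on at most `m` points.
  refine ⟨fun i k => ⟨(S k i).card / m, Nat.lt_succ_of_le (hSN k i)⟩, fun v => ?_⟩
  let Tv : Set I := {i | i ∈ T ∧ ∀ k, (S k i).card / m = v k}
  let V : Fin K → Finset α := fun k =>
    U.filter fun p => (∃ i ∈ Tv, p ∈ S k i) ∧ ∃ j ∈ Tv, p ∉ S k j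
  have hVcard : ∀ k, (V k).card ≤ m := by
    intro k
    refine card_chain_disagreement_le (T := Tv) (S := S k) (a := m * v k) ?_ ?_ _
      fun p hp => (Finset.mem_filter.1 hp).2
    · intro i hi j hj
      by_contra! hcon
      obtain ⟨p, hpi, hpj⟩ := Finset.not_subset.1 hcon.1
      obtain ⟨q, hqj, hqi⟩ := Finset.not_subset.1 hcon.2
      simp only [S, Finset.mem_filter, not_and] at hpi hpj hqi hqj
      rcases le_total (W p) (W q) with h | h
      · exact hpj hpi.1 (hqj.2.trans (div_le_div_of_nonneg_right (hanti j hj.1 _ _ h) hδ0.le))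
      · exact hqi hqj.1 (hpi.2.trans (div_le_div_of_nonneg_right (hanti i hi.1 _ _ h) hδ0.le))
    · intro i hi
      have h1 := hi.2 k
      have h2 := Nat.div_add_mod (S k i).card m
      have h3 := Nat.mod_lt (S k i).card hm
      rw [h1] at h2
      omega
  -- The 1 pays for rounding to multiples of `δ`; the sum counts the levels on which the class
  -- disagrees at `p`.
  refine ⟨fun p => δ * (1 + ∑ k, if p ∈ V k then 1 else 0), fun p => ?_, ?_, ?_⟩
  · have : (0 : ℝ) ≤ ∑ k, if p ∈ V k then 1 else 0 :=
      Finset.sum_nonneg fun k _ => by split_ifs <;> norm_num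
    positivity
  · have key : ∀ i ∈ Tv, ∀ j ∈ Tv, ∀ p ∈ U,
        f i p - f j p ≤ δ * (1 + ∑ k, if p ∈ V k then 1 else 0) := by
      intro i hi j hj p hp
      have hx : ∀ i ∈ Tv, 0 ≤ f i p / δ ∧ f i p / δ ≤ K := fun i hi =>
        ⟨div_nonneg (hf i hi.1 p).1 hδ0.le, by
          rw [div_le_iff₀ hδ0, hδ, mul_div_cancel₀ _ hK'.ne']
          exact (hf i hi.1 p).2⟩
      have h1 := sum_levels (hx i hi).1 (hx i hi).2
      have h2 := sum_levels (hx j hj).1 (hx j hj).2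
      have h3 : (∑ k : Fin K, if ((k : ℕ) : ℝ) + 1 ≤ f i p / δ then (1 : ℝ) else 0) ≤
          (∑ k : Fin K, if ((k : ℕ) : ℝ) + 1 ≤ f j p / δ then (1 : ℝ) else 0) +
            ∑ k, if p ∈ V k then 1 else 0 := by
        rw [← Finset.sum_add_distrib]
        refine Finset.sum_le_sum fun k _ => ?_
        by_cases hi' : ((k : ℕ) : ℝ) + 1 ≤ f i p / δ
        · by_cases hj' : ((k : ℕ) : ℝ) + 1 ≤ f j p / δ
          · rw [if_pos hi', if_pos hj']
            split_ifs <;> norm_num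
          · have : p ∈ V k := Finset.mem_filter.2 ⟨hp, ⟨i, hi, Finset.mem_filter.2 ⟨hp, hi'⟩⟩,
              j, hj, fun h => hj' (Finset.mem_filter.1 h).2⟩
            rw [if_pos hi', if_neg hj', if_pos this]
            norm_num
        · rw [if_neg hi']
          positivity
      rw [h1, h2] at h3
      have h4 := Nat.lt_floor_add_one (f i p / δ)
      have h5 := Nat.floor_le (hx j hj).1
      have h6 : f i p / δ - f j p / δ ≤ 1 + ∑ k, if p ∈ V k then (1 : ℝ) else 0 := by linarith
      rwa [← sub_div, div_le_iff₀' hδ0] at h6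
    intro i hi j hj hiv hjv p hp
    have hi' : i ∈ Tv := ⟨hi, fun k => by rw [← hiv]⟩
    have hj' : j ∈ Tv := ⟨hj, fun k => by rw [← hjv]⟩
    rw [abs_le]
    constructor <;> linarith [key i hi' j hj' p hp, key j hj' i hi' p hp]
  · rw [← Finset.mul_sum, Finset.sum_add_distrib, Finset.sum_comm]
    have h1 : ∑ k, ∑ p ∈ U, (if p ∈ V k then (1 : ℝ) else 0) ≤ K * m := by
      refine (Finset.sum_le_card_nsmul Finset.univ _ (m : ℝ) fun k _ => ?_).trans (by simp)
      rw [Finset.sum_boole]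
      have : U.filter (fun p => p ∈ V k) ⊆ V k := fun p hp => (Finset.mem_filter.1 hp).2
      exact_mod_cast (Finset.card_le_card this).trans (hVcard k)
    calc δ * (∑ _p ∈ U, 1 + ∑ k, ∑ p ∈ U, (if p ∈ V k then (1 : ℝ) else 0))
        ≤ δ * (U.card + K * m) := by
          refine mul_le_mul_of_nonneg_left ?_ hδ0.le
          simpa using h1
      _ = A * (U.card / K + m) := by
          rw [hδ]
          field_simp

/-- Row sums of a matrix with summable decay off the diagonal. -/
lemma sum_natAbs_sub_le_tsum {g : ℕ → ℝ} (hg : Summable g) (hg0 : ∀ k, 0 ≤ g k) {n : ℕ}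
    (i : Fin n) : ∑ j : Fin n, g ((i : ℤ) - j).natAbs ≤ 2 * ∑' k, g k := by
  have hinj : ∀ s : Finset (Fin n), (∀ j ∈ s, ∀ j' ∈ s,
      ((i : ℤ) - j).natAbs = ((i : ℤ) - j').natAbs → j = j') →
      ∑ j ∈ s, g ((i : ℤ) - j).natAbs ≤ ∑' k, g k := by
    intro s hs
    rw [← Finset.sum_image (f := g) (g := fun j : Fin n => ((i : ℤ) - j).natAbs)
      fun j hj j' hj' h => hs j hj j' hj' h]
    exact hg.sum_le_tsum _ fun k _ => hg0 k
  -- The distance to `i` is injective on either side of `i`; hence the factor 2.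
  rw [← Finset.sum_filter_add_sum_filter_not Finset.univ (fun j => j ≤ i), two_mul]
  refine add_le_add (hinj _ ?_) (hinj _ ?_)
  · intro j hj j' hj' h
    simp only [Finset.mem_filter, Finset.mem_univ, true_and, Fin.le_def] at hj hj'
    apply Fin.ext
    omega
  · intro j hj j' hj' h
    simp only [Finset.mem_filter, Finset.mem_univ, true_and, Fin.le_def] at hj hj'
    apply Fin.ext
    omega

end Covering

/-! ### Brackets for a single inverse -/

section InverseBracket

variable {ι : Type*} [Fintype ι] [DecidableEq ι]

lemma abs_dotProduct_inv_mulVec_le {A : Matrix ι ι ℝ} {c : ℝ} (hA : IsUnit A.det) (hc : 0 < c)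
    (h : ∀ x, c * (x ⬝ᵥ x) ≤ x ⬝ᵥ A *ᵥ x) (x : ι → ℝ) :
    |x ⬝ᵥ A⁻¹ *ᵥ x| ≤ c⁻¹ * (x ⬝ᵥ x) := by
  have hx := dotProduct_self_nonneg_real x
  refine abs_le_of_sq_le_sq ?_ (by positivity)
  have h1 := sq_mul_dotProduct_inv_mulVec_le hA hc h x
  rw [← le_div_iff₀' (by positivity)] at h1
  refine (dotProduct_sq_le _ _).trans ((mul_le_mul_of_nonneg_left h1 hx).trans (le_of_eq ?_))
  field_simp

lemma dotProduct_bracket {S : Matrix ι ι ℝ} (hS : S.IsSymm) (b : ι → ℝ) (α β : ℝ) (y : ι → ℝ) :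
    y ⬝ᵥ (α • (1 : Matrix ι ι ℝ) + β • (S * diagonal b * S)) *ᵥ y =
      α * (y ⬝ᵥ y) + β * ∑ j, b j * (S *ᵥ y) j ^ 2 := by
  rw [add_mulVec, smul_mulVec, smul_mulVec, one_mulVec, dotProduct_add, dotProduct_smul,
    dotProduct_smul, smul_eq_mul, smul_eq_mul, ← mulVec_mulVec, ← mulVec_mulVec,
    dotProduct_mulVec y S, ← mulVec_transpose, hS.eq]
  congr 2
  simp only [dotProduct, mulVec_diagonal]
  exact Finset.sum_congr rfl fun j _ => by ring

/-- A bracket for the quadratic forms of the inverses of the matrices near a given one. -/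
lemma abs_dotProduct_inv_sub_le {A A' B : Matrix ι ι ℝ} (hA : A.IsSymm) {c C ρ : ℝ} (hc : 0 < c)
    (hρ : 0 < ρ) (hdA : IsUnit A.det) (hdA' : IsUnit A'.det)
    (hcA : ∀ x, c * (x ⬝ᵥ x) ≤ x ⬝ᵥ A *ᵥ x) (hA' : A'.IsSymm)
    (hrow : ∀ i, ∑ j, |A' i j - A i j| ≤ C) (hB : ∀ i j, |A' i j - A i j| ≤ B i j)
    (y : ι → ℝ) :
    |y ⬝ᵥ A⁻¹ *ᵥ y - y ⬝ᵥ A'⁻¹ *ᵥ y| ≤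
      y ⬝ᵥ ((ρ / (2 * c ^ 2)) • (1 : Matrix ι ι ℝ) + (C / (2 * ρ)) •
        (A'⁻¹ * diagonal (fun j => ∑ i, B i j) * A'⁻¹)) *ᵥ y := by
  have hsymm' : (A'⁻¹).IsSymm := by rw [IsSymm, transpose_nonsing_inv, hA'.eq]
  have hsymm : (A⁻¹).IsSymm := by rw [IsSymm, transpose_nonsing_inv, hA.eq]
  rw [dotProduct_bracket hsymm']
  set z := A'⁻¹ *ᵥ y
  set u := A⁻¹ *ᵥ y
  set w := (A' - A) *ᵥ z
  -- The resolvent identity A⁻¹ − A'⁻¹ = A⁻¹(A' − A)A'⁻¹.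
  have h1 : y ⬝ᵥ u - y ⬝ᵥ z = u ⬝ᵥ w := by
    have hu : A *ᵥ u = y := by rw [mulVec_mulVec, mul_nonsing_inv _ hdA, one_mulVec]
    have hz : A' *ᵥ z = y := by rw [mulVec_mulVec, mul_nonsing_inv _ hdA', one_mulVec]
    rw [show w = y - A *ᵥ z by rw [show w = _ from sub_mulVec _ _ _, hz], dotProduct_sub,
      dotProduct_mulVec u, ← mulVec_transpose, hA.eq, hu, dotProduct_comm u y]
  -- Weighted Young inequality: `u` needs only the spectral bound, and `w` applies A' − A to a
  -- vector that depends on the representative A' alone.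
  have h2 : |u ⬝ᵥ w| ≤ ρ / 2 * (u ⬝ᵥ u) + 1 / (2 * ρ) * (w ⬝ᵥ w) := by
    simp only [dotProduct, Finset.mul_sum]
    rw [← Finset.sum_add_distrib]
    refine (Finset.abs_sum_le_sum_abs _ _).trans (Finset.sum_le_sum fun i _ => ?_)
    have h3 : ρ / 2 * (u i * u i) + 1 / (2 * ρ) * (w i * w i) - u i * w i =
        (ρ * u i - w i) ^ 2 / (2 * ρ) := by field_simp; ring
    have h4 : ρ / 2 * (u i * u i) + 1 / (2 * ρ) * (w i * w i) + u i * w i =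
        (ρ * u i + w i) ^ 2 / (2 * ρ) := by field_simp; ring
    have h5 : 0 ≤ (ρ * u i - w i) ^ 2 / (2 * ρ) := by positivity
    have h6 : 0 ≤ (ρ * u i + w i) ^ 2 / (2 * ρ) := by positivity
    rw [abs_le]
    constructor <;> linarith
  have h3 : u ⬝ᵥ u ≤ (y ⬝ᵥ y) / c ^ 2 := by
    rw [le_div_iff₀' (by positivity)]
    exact sq_mul_dotProduct_inv_mulVec_le hdA hc hcA y
  have h4 : w ⬝ᵥ w ≤ C * ∑ j, (∑ i, B i j) * z j ^ 2 := by
    refine (dotProduct_mulVec_self_le (D := A' - A) hrow z).trans ?_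
    rcases isEmpty_or_nonempty ι with hι | ⟨⟨i₀⟩⟩
    · simp
    have hC : 0 ≤ C := (Finset.sum_nonneg fun j _ => abs_nonneg _).trans (hrow i₀)
    refine mul_le_mul_of_nonneg_left ?_ hC
    rw [Finset.sum_comm]
    refine Finset.sum_le_sum fun j _ => ?_
    rw [Finset.sum_mul]
    exact Finset.sum_le_sum fun i _ => mul_le_mul_of_nonneg_right (hB i j) (sq_nonneg _)
  rw [h1]
  refine h2.trans ?_
  calc ρ / 2 * (u ⬝ᵥ u) + 1 / (2 * ρ) * (w ⬝ᵥ w)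
      ≤ ρ / 2 * ((y ⬝ᵥ y) / c ^ 2) + 1 / (2 * ρ) * (C * ∑ j, (∑ i, B i j) * z j ^ 2) := by gcongr
    _ = _ := by
      field_simp

lemma isHermitian_bracket {S : Matrix ι ι ℝ} (hS : S.IsSymm) (b : ι → ℝ) (α β : ℝ) :
    (α • (1 : Matrix ι ι ℝ) + β • (S * diagonal b * S)).IsHermitian := by
  rw [IsHermitian, conjTranspose_eq_transpose_of_trivial]
  simp [transpose_add, transpose_smul, transpose_mul, hS.eq, Matrix.mul_assoc]

lemma abs_dotProduct_bracket_le {S : Matrix ι ι ℝ} (hS : S.IsSymm) {b : ι → ℝ} {α β c D : ℝ}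
    (hα : 0 ≤ α) (hβ : 0 ≤ β) (hc : 0 < c) (hb : ∀ j, 0 ≤ b j) (hbD : ∀ j, b j ≤ D) (hD : 0 ≤ D)
    (hSc : ∀ x, c ^ 2 * ((S *ᵥ x) ⬝ᵥ (S *ᵥ x)) ≤ x ⬝ᵥ x) (y : ι → ℝ) :
    |y ⬝ᵥ (α • (1 : Matrix ι ι ℝ) + β • (S * diagonal b * S)) *ᵥ y| ≤
      (α + β * (D / c ^ 2)) * (y ⬝ᵥ y) := by
  have hy := dotProduct_self_nonneg_real y
  rw [dotProduct_bracket hS]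
  have h1 : 0 ≤ ∑ j, b j * (S *ᵥ y) j ^ 2 :=
    Finset.sum_nonneg fun j _ => mul_nonneg (hb j) (sq_nonneg _)
  have h2 : ∑ j, b j * (S *ᵥ y) j ^ 2 ≤ D * ((y ⬝ᵥ y) / c ^ 2) := by
    have h3 : (S *ᵥ y) ⬝ᵥ (S *ᵥ y) ≤ (y ⬝ᵥ y) / c ^ 2 := by
      rw [le_div_iff₀' (by positivity)]
      exact hSc y
    refine le_trans ?_ (mul_le_mul_of_nonneg_left h3 hD)
    rw [dotProduct, Finset.mul_sum]
    refine Finset.sum_le_sum fun j _ => ?_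
    rw [← sq]
    exact mul_le_mul_of_nonneg_right (hbD j) (sq_nonneg _)
  rw [abs_of_nonneg (by positivity), add_mul, mul_assoc]
  refine add_le_add le_rfl (mul_le_mul_of_nonneg_left (h2.trans (le_of_eq ?_)) hβ)
  ring

/-- The second term is Σ bⱼ(SRS)ⱼⱼ with each (SRS)ⱼⱼ ≤ C/c², so only the total mass of `b` matters.
-/
lemma trace_bracket_mul_le {S R : Matrix ι ι ℝ} (hS : S.IsSymm) {b : ι → ℝ} {α β c C : ℝ}
    (hα : 0 ≤ α) (hβ : 0 ≤ β) (hc : 0 < c) (hC : 0 ≤ C) (hb : ∀ j, 0 ≤ b j)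
    (hSc : ∀ x, c ^ 2 * ((S *ᵥ x) ⬝ᵥ (S *ᵥ x)) ≤ x ⬝ᵥ x)
    (hR : ∀ x, x ⬝ᵥ R *ᵥ x ≤ C * (x ⬝ᵥ x)) :
    ((α • (1 : Matrix ι ι ℝ) + β • (S * diagonal b * S)) * R).trace ≤
      α * C * Fintype.card ι + β * (C / c ^ 2) * ∑ j, b j := by
  rw [add_mul, smul_mul_assoc, smul_mul_assoc, trace_add, trace_smul, trace_smul, smul_eq_mul,
    smul_eq_mul, Matrix.one_mul, mul_assoc α, mul_assoc β]
  refine add_le_add (mul_le_mul_of_nonneg_left ?_ hα) (mul_le_mul_of_nonneg_left ?_ hβ)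
  · rw [trace, mul_comm, ← nsmul_eq_mul, ← Finset.card_univ]
    refine Finset.sum_le_card_nsmul _ _ _ fun i _ => ?_
    simpa using hR (Pi.single i 1)
  · rw [Matrix.mul_assoc, Matrix.mul_assoc, trace_mul_comm, Matrix.mul_assoc, trace, Finset.mul_sum]
    refine Finset.sum_le_sum fun j _ => ?_
    rw [diag_apply, diagonal_mul, mul_comm]
    refine mul_le_mul_of_nonneg_right ?_ (hb j)
    have h1 := hR (S *ᵥ Pi.single j 1)
    have h2 := hSc (Pi.single j 1)
    have h3 : (S *ᵥ Pi.single j 1) ⬝ᵥ R *ᵥ (S *ᵥ Pi.single j 1) = (S * R * S) j j := by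
      nth_rewrite 1 [← hS.eq]
      rw [mulVec_transpose, ← dotProduct_mulVec, mulVec_mulVec, mulVec_mulVec]
      simp
    rw [h3] at h1
    rw [← le_div_iff₀' (by positivity)] at h2
    refine h1.trans ((mul_le_mul_of_nonneg_left h2 hC).trans (le_of_eq ?_))
    simp [div_eq_mul_inv]

end InverseBracket

/-! ### Brackets for covariance matrices -/

section Brackets

/-- The number of pairs of indices in a band around the diagonal. -/
lemma card_band_le (n T : ℕ) :
    ((Finset.univ : Finset (Fin n × Fin n)).filter
      fun p => ((p.1 : ℤ) - p.2).natAbs < T).card ≤ 2 * T * n := by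
  have hT : ∀ k ∉ Finset.range T, (if k < T then (1 : ℝ) else 0) = 0 := fun k hk =>
    if_neg fun h => hk (Finset.mem_range.2 h)
  have hsum : ∑' k, (if k < T then (1 : ℝ) else 0) = T := by
    rw [tsum_eq_sum hT, Finset.sum_congr rfl fun k hk => if_pos (Finset.mem_range.1 hk)]
    simp
  have h1 : ∀ i : Fin n, ∑ j : Fin n, (if ((i : ℤ) - j).natAbs < T then (1 : ℝ) else 0) ≤ 2 * T := by
    intro i
    rw [← hsum]
    exact sum_natAbs_sub_le_tsum (g := fun k => if k < T then (1 : ℝ) else 0)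
      (summable_of_ne_finset_zero hT) (fun k => by split_ifs <;> norm_num) i
  have h2 : (((Finset.univ : Finset (Fin n × Fin n)).filter
      fun p => ((p.1 : ℤ) - p.2).natAbs < T).card : ℝ) ≤ 2 * T * n := by
    rw [← Finset.sum_boole, Fintype.sum_prod_type]
    refine (Finset.sum_le_card_nsmul Finset.univ _ (2 * (T : ℝ)) fun i _ => h1 i).trans ?_
    rw [Finset.card_univ, Fintype.card_fin, nsmul_eq_mul, mul_comm]
  exact_mod_cast h2

/-- A bracketing, with small total mass, of a family of matrices with nonnegative entries that are
nonincreasing in some function of the pair of indices and decay off the diagonal. -/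
lemma exists_bracketing_matrix {V : Type*} {A C η : ℝ} (hA : 0 < A) (hη : 0 < η) {e : ℕ → ℝ}
    (he : Summable e) (he0 : ∀ k, 0 ≤ e k) (heA : ∀ k, e k ≤ A) (heC : 2 * ∑' k, e k ≤ C) :
    ∃ K N : ℕ, ∀ᶠ n : ℕ in atTop, ∀ (Θ : Set V) (R : V → Matrix (Fin n) (Fin n) ℝ)
      (W : Fin n → Fin n → ℝ),
      (∀ θ ∈ Θ, ∀ i j, 0 ≤ R θ i j ∧ R θ i j ≤ e ((i : ℤ) - j).natAbs) →
      (∀ θ ∈ Θ, ∀ i j k l, W i j ≤ W k l → R θ k l ≤ R θ i j) →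
      ∃ cl : V → Fin K → Fin (N + 1), ∀ v, ∃ B : Matrix (Fin n) (Fin n) ℝ,
        (∀ i j, 0 ≤ B i j) ∧ (∀ j, ∑ i, B i j ≤ 2 * C) ∧ ∑ j, ∑ i, B i j ≤ η * n ∧
        ∀ θ ∈ Θ, ∀ θ' ∈ Θ, cl θ = v → cl θ' = v → ∀ i j, |R θ i j - R θ' i j| ≤ B i j := by
  -- Three errors of at most ηn/4 each: the tail outside a band of width `T`, the rounding to `K`
  -- levels inside the band, and the cell size m ≈ n/q of the cardinality classes.
  obtain ⟨T, hT⟩ : ∃ T, ∑' k, e (k + T) < η / 8 :=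
    ((tendsto_order.1 (tendsto_sum_nat_add e)).2 _ (by positivity)).exists
  obtain ⟨K, hK⟩ := exists_nat_gt (8 * A * T / η)
  have hK0 : 0 < K := by
    have : 0 ≤ 8 * A * T / η := by positivity
    exact_mod_cast this.trans_lt hK
  obtain ⟨q, hq⟩ := exists_nat_gt (8 * A / η)
  have hq0 : 0 < q := by
    have : 0 ≤ 8 * A / η := by positivity
    exact_mod_cast this.trans_lt hq
  have hKR : (0 : ℝ) < K := by exact_mod_cast hK0
  have hqR : (0 : ℝ) < q := by exact_mod_cast hq0
  let g : ℕ → ℝ := fun k => if k < T then 0 else e k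
  have hg0 : ∀ k, 0 ≤ g k := fun k => by
    simp only [g]
    split_ifs
    exacts [le_rfl, he0 k]
  have hg : Summable g := Summable.of_nonneg_of_le hg0 (fun k => by
    simp only [g]
    split_ifs
    exacts [he0 k, le_rfl]) he
  have hgsum : ∑' k, g k = ∑' k, e (k + T) := by
    rw [← hg.sum_add_tsum_nat_add T, Finset.sum_eq_zero fun k hk => if_pos (Finset.mem_range.1 hk),
      zero_add]
    exact tsum_congr fun k => if_neg (by omega)
  refine ⟨K, 2 * T * q, ?_⟩
  filter_upwards [eventually_ge_atTop q] with n hn Θ R W hR hW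
  set m := n / q + 1 with hm
  have hnm : n ≤ q * m := (Nat.lt_mul_div_succ n hq0).le
  have hmn : (m : ℝ) ≤ 2 * n / q := by
    have h1 : ((n / q : ℕ) : ℝ) ≤ n / q := Nat.cast_div_le
    have h2 : (1 : ℝ) ≤ n / q := by
      rw [le_div_iff₀ hqR, one_mul]
      exact_mod_cast hn
    rw [hm]
    push_cast
    rw [mul_div_assoc]
    linarith
  set U := (Finset.univ : Finset (Fin n × Fin n)).filter fun p => ((p.1 : ℤ) - p.2).natAbs < T
    with hU
  have hUcard : U.card ≤ 2 * T * n := card_band_le n T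
  obtain ⟨cl, hcl⟩ := exists_bracketing_antitone Θ U (fun p => W p.1 p.2)
    (fun θ p => R θ p.1 p.2) hA
    (fun θ hθ p => ⟨(hR θ hθ p.1 p.2).1, (hR θ hθ p.1 p.2).2.trans (heA _)⟩)
    (fun θ hθ p q h => hW θ hθ _ _ _ _ h) hK0 (Nat.succ_pos _ : 0 < m)
    (N := 2 * T * q) (hUcard.trans (by
      rw [mul_assoc (2 * T)]
      exact Nat.mul_le_mul_left _ hnm))
  refine ⟨cl, fun v => ?_⟩
  obtain ⟨B, hB0, hB, hBsum⟩ := hcl v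
  have hdiff : ∀ θ ∈ Θ, ∀ θ' ∈ Θ, ∀ i j, |R θ i j - R θ' i j| ≤ e ((i : ℤ) - j).natAbs := by
    intro θ hθ θ' hθ' i j
    rw [abs_le]
    constructor <;> linarith [(hR θ hθ i j).1, (hR θ hθ i j).2, (hR θ' hθ' i j).1,
      (hR θ' hθ' i j).2]
  -- The minimum with the envelope keeps the column sums bounded.
  refine ⟨Matrix.of fun i j => if (i, j) ∈ U then min (B (i, j)) (e ((i : ℤ) - j).natAbs)
    else e ((i : ℤ) - j).natAbs, fun i j => ?_, fun j => ?_, ?_, fun θ hθ θ' hθ' h h' i j => ?_⟩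
  · rw [of_apply]
    split_ifs
    exacts [le_min (hB0 _) (he0 _), he0 _]
  · have h1 := sum_natAbs_sub_le_tsum he he0 j
    have h2 : ∑ i : Fin n, e ((i : ℤ) - j).natAbs = ∑ i : Fin n, e ((j : ℤ) - i).natAbs :=
      Finset.sum_congr rfl fun i _ => by rw [← Int.natAbs_neg, neg_sub]
    have h3 : 0 ≤ ∑' k, e k := tsum_nonneg he0
    refine (Finset.sum_le_sum fun i _ => ?_ : _ ≤ ∑ i : Fin n, e ((i : ℤ) - j).natAbs).trans
      (by linarith)
    rw [of_apply]
    split_ifs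
    exacts [min_le_right _ _, le_rfl]
  · have h1 : ∑ j : Fin n, ∑ i : Fin n, (Matrix.of fun i j => if (i, j) ∈ U then
          min (B (i, j)) (e ((i : ℤ) - j).natAbs) else e ((i : ℤ) - j).natAbs) i j ≤
        ∑ p ∈ U, B p + ∑ i : Fin n, ∑ j : Fin n, g ((i : ℤ) - j).natAbs := by
      have h2 : ∑ p ∈ U, B p = ∑ i, ∑ j, if (i, j) ∈ U then B (i, j) else 0 := by
        rw [← Fintype.sum_prod_type' fun i j => if (i, j) ∈ U then B (i, j) else 0]
        simp
      rw [Finset.sum_comm, h2, ← Finset.sum_add_distrib]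
      refine Finset.sum_le_sum fun i _ => ?_
      rw [← Finset.sum_add_distrib]
      refine Finset.sum_le_sum fun j _ => ?_
      rw [of_apply]
      by_cases hij : (i, j) ∈ U
      · rw [if_pos hij, if_pos hij]
        exact (min_le_left _ _).trans (le_add_of_nonneg_right (hg0 _))
      · have : ¬ ((i : ℤ) - j).natAbs < T := fun h =>
          hij (Finset.mem_filter.2 ⟨Finset.mem_univ _, h⟩)
        simp only [if_neg hij, g, if_neg this, zero_add, le_refl]
    have h3 : ∑ i : Fin n, ∑ j : Fin n, g ((i : ℤ) - j).natAbs ≤ η / 4 * n := by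
      refine (Finset.sum_le_card_nsmul Finset.univ _ (η / 4) fun i _ => ?_).trans ?_
      · have := sum_natAbs_sub_le_tsum hg hg0 i
        rw [hgsum] at this
        linarith
      · rw [Finset.card_univ, Fintype.card_fin, nsmul_eq_mul, mul_comm]
    have hn0 : (0 : ℝ) ≤ n := Nat.cast_nonneg n
    have h4 : A * (U.card / K) ≤ η / 4 * n := by
      have h5 : (U.card : ℝ) ≤ 2 * T * n := by exact_mod_cast hUcard
      rw [div_lt_iff₀ hη] at hK
      rw [← mul_div_assoc, div_le_iff₀ hKR]
      nlinarith [mul_le_mul_of_nonneg_left h5 hA.le]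
    have h6 : A * m ≤ η / 4 * n := by
      refine (mul_le_mul_of_nonneg_left hmn hA.le).trans ?_
      rw [div_lt_iff₀ hη] at hq
      rw [← mul_div_assoc, div_le_iff₀ hqR]
      nlinarith
    rw [mul_add] at hBsum
    have h7 : 0 ≤ η * n := by positivity
    linarith
  · rw [of_apply]
    split_ifs with hij
    · exact le_min (hB θ hθ θ' hθ' h h' _ hij) (hdiff θ hθ θ' hθ' i j)
    · exact hdiff θ hθ θ' hθ' i j

end Brackets

/-! ### Brackets for all the inverses -/

section InverseBrackets

/-- A finite bracketing, of a size that does not depend on `n`, of the quadratic forms of the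
inverses of a family of covariance matrices. -/
lemma exists_bracketing_inverse {V : Type*} {A C c ε : ℝ} (hA : 0 < A) (hC : 0 < C) (hc : 0 < c)
    (hε : 0 < ε) {e : ℕ → ℝ} (he : Summable e) (he0 : ∀ k, 0 ≤ e k) (heA : ∀ k, e k ≤ A)
    (heC : 2 * ∑' k, e k ≤ C) :
    ∃ (K N : ℕ) (m : ℝ), 0 ≤ m ∧ ∀ᶠ n : ℕ in atTop,
      ∀ (Θ : Set V) (R : V → Matrix (Fin n) (Fin n) ℝ) (W : Fin n → Fin n → ℝ)
        (R₀ : Matrix (Fin n) (Fin n) ℝ),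
      (∀ θ ∈ Θ, (R θ).IsHermitian) →
      (∀ θ ∈ Θ, ∀ i j, 0 ≤ R θ i j ∧ R θ i j ≤ e ((i : ℤ) - j).natAbs) →
      (∀ θ ∈ Θ, ∀ i j k l, W i j ≤ W k l → R θ k l ≤ R θ i j) →
      (∀ θ ∈ Θ, ∀ x, c * (x ⬝ᵥ x) ≤ x ⬝ᵥ R θ *ᵥ x) →
      (∀ x, x ⬝ᵥ R₀ *ᵥ x ≤ C * (x ⬝ᵥ x)) →
      ∃ M N : (Fin K → Fin (N + 1)) → Matrix (Fin n) (Fin n) ℝ,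
        (∀ v, (M v).IsHermitian ∧ ∀ x, |x ⬝ᵥ M v *ᵥ x| ≤ m * (x ⬝ᵥ x)) ∧
        (∀ v, (N v).IsHermitian ∧ ∀ x, |x ⬝ᵥ N v *ᵥ x| ≤ m * (x ⬝ᵥ x)) ∧
        (∀ v, (N v * R₀).trace ≤ ε * n) ∧
        ∀ θ ∈ Θ, ∃ v, ∀ y, |y ⬝ᵥ (R θ)⁻¹ *ᵥ y - y ⬝ᵥ M v *ᵥ y| ≤ y ⬝ᵥ N v *ᵥ y := by
  -- This `ρ`, with bracket mass ε²c⁴/C³ per point, makes each of the two trace terms εn/2.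
  set ρ := ε * c ^ 2 / C with hρ
  have hρ0 : 0 < ρ := by positivity
  obtain ⟨K, N, hKN⟩ := exists_bracketing_matrix (V := V) hA
    (show 0 < ε ^ 2 * c ^ 4 / C ^ 3 by positivity) he he0 heA heC
  set α := ρ / (2 * c ^ 2) with hα
  set β := C / (2 * ρ) with hβ
  refine ⟨K, N, c⁻¹ + (α + β * (2 * C / c ^ 2)), by positivity, ?_⟩
  filter_upwards [hKN] with n hn Θ R W R₀ hherm hR hW hcR hCR
  obtain ⟨cl, hcl⟩ := hn Θ R W hR hW
  have hm1 : c⁻¹ ≤ c⁻¹ + (α + β * (2 * C / c ^ 2)) := le_add_of_nonneg_right (by positivity)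
  have hm2 : α + β * (2 * C / c ^ 2) ≤ c⁻¹ + (α + β * (2 * C / c ^ 2)) :=
    le_add_of_nonneg_left (by positivity)
  have hdet : ∀ θ ∈ Θ, IsUnit (R θ).det := fun θ hθ =>
    (isUnit_iff_isUnit_det _).1 (posDef_of_le_dotProduct_mulVec (hherm θ hθ) hc (hcR θ hθ)).isUnit
  have hsymm : ∀ θ ∈ Θ, (R θ).IsSymm := fun θ hθ => by
    have := hherm θ hθ
    rwa [IsHermitian, conjTranspose_eq_transpose_of_trivial] at this
  have key : ∀ v, ∃ M N : Matrix (Fin n) (Fin n) ℝ,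
      (M.IsHermitian ∧ ∀ x, |x ⬝ᵥ M *ᵥ x| ≤ (c⁻¹ + (α + β * (2 * C / c ^ 2))) * (x ⬝ᵥ x)) ∧
      (N.IsHermitian ∧ ∀ x, |x ⬝ᵥ N *ᵥ x| ≤ (c⁻¹ + (α + β * (2 * C / c ^ 2))) * (x ⬝ᵥ x)) ∧
      (N * R₀).trace ≤ ε * n ∧
      ∀ θ ∈ Θ, cl θ = v → ∀ y, |y ⬝ᵥ (R θ)⁻¹ *ᵥ y - y ⬝ᵥ M *ᵥ y| ≤ y ⬝ᵥ N *ᵥ y := by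
    intro v
    by_cases hv : ∃ θ ∈ Θ, cl θ = v
    · obtain ⟨θ', hθ', hv'⟩ := hv
      obtain ⟨B, hB0, hBcol, hBsum, hB⟩ := hcl v
      have hinv : ((R θ')⁻¹).IsSymm := by
        rw [IsSymm, transpose_nonsing_inv, (hsymm θ' hθ').eq]
      have hinv' := sq_mul_dotProduct_inv_mulVec_le (hdet θ' hθ') hc (hcR θ' hθ')
      have hb : ∀ j, 0 ≤ ∑ i, B i j := fun j => Finset.sum_nonneg fun i _ => hB0 i j
      refine ⟨(R θ')⁻¹, α • (1 : Matrix (Fin n) (Fin n) ℝ) +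
        β • ((R θ')⁻¹ * diagonal (fun j => ∑ i, B i j) * (R θ')⁻¹), ⟨(hherm θ' hθ').inv, fun x => ?_⟩,
        ⟨isHermitian_bracket hinv _ _ _, fun x => ?_⟩, ?_, fun θ hθ hθv y => ?_⟩
      · exact (abs_dotProduct_inv_mulVec_le (hdet θ' hθ') hc (hcR θ' hθ') x).trans
          (mul_le_mul_of_nonneg_right hm1 (dotProduct_self_nonneg_real x))
      · exact (abs_dotProduct_bracket_le hinv (by positivity) (by positivity) hc hb hBcol
          (by positivity) hinv' x).trans
          (mul_le_mul_of_nonneg_right hm2 (dotProduct_self_nonneg_real x))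
      · refine (trace_bracket_mul_le hinv (by positivity) (by positivity) hc hC.le hb hinv'
          hCR).trans ?_
        rw [Fintype.card_fin]
        have h1 : β * (C / c ^ 2) * ∑ j, ∑ i, B i j ≤
            β * (C / c ^ 2) * (ε ^ 2 * c ^ 4 / C ^ 3 * n) :=
          mul_le_mul_of_nonneg_left hBsum (by positivity)
        refine (add_le_add le_rfl h1).trans (le_of_eq ?_)
        rw [hα, hβ, hρ]
        field_simp
        ring
      · refine abs_dotProduct_inv_sub_le (hsymm θ hθ) hc hρ0 (hdet θ hθ) (hdet θ' hθ') (hcR θ hθ)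
          (hsymm θ' hθ') (fun i => ?_) (hB θ' hθ' θ hθ hv' hθv) y
        refine le_trans (Finset.sum_le_sum fun j _ => ?_)
          ((sum_natAbs_sub_le_tsum he he0 i).trans heC)
        rw [abs_le]
        constructor <;> linarith [(hR θ hθ i j).1, (hR θ hθ i j).2, (hR θ' hθ' i j).1,
          (hR θ' hθ' i j).2]
    -- An empty class has no representative; zero matrices serve.
    · refine ⟨0, 0, ⟨isHermitian_zero, fun x => ?_⟩, ⟨isHermitian_zero, fun x => ?_⟩, ?_,
        fun θ hθ h => absurd ⟨θ, hθ, h⟩ hv⟩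
      · have := dotProduct_self_nonneg_real x
        simp only [zero_mulVec, dotProduct_zero, abs_zero]
        positivity
      · have := dotProduct_self_nonneg_real x
        simp only [zero_mulVec, dotProduct_zero, abs_zero]
        positivity
      · simp only [Matrix.zero_mul, trace_zero]
        positivity
  choose M N h1 h2 h3 h4 using key
  exact ⟨M, N, h1, h2, h3, fun θ hθ => ⟨cl θ, h4 _ θ hθ rfl⟩⟩

end InverseBrackets

/-! ### Uniform law of large numbers -/

section UniformLaw

/-- A uniform law of large numbers for the quadratic forms of the inverse covariance matrices. -/
lemma tendsto_measure_exists_deviation {V Ω E : Type*} [MeasurableSpace Ω] {P : Measure Ω}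
    [IsProbabilityMeasure P] {Y : E → Ω → ℝ} {k₀ : E → E → ℝ}
    (hY : IsCenteredGaussianProcess Y k₀ P) (x : (n : ℕ) → Fin n → E) (Θ : Set V)
    (R : (n : ℕ) → V → Matrix (Fin n) (Fin n) ℝ) (W : (n : ℕ) → Fin n → Fin n → ℝ)
    {A c ε : ℝ} (hA : 0 < A) (hc : 0 < c) (hε : 0 < ε) {e : ℕ → ℝ} (he : Summable e)
    (he0 : ∀ k, 0 ≤ e k) (heA : ∀ k, e k ≤ A) {θ₀ : V} (hθ₀ : θ₀ ∈ Θ)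
    (hR₀ : ∀ n, R n θ₀ = covMatrix k₀ (x n))
    (hherm : ∀ n, ∀ θ ∈ Θ, (R n θ).IsHermitian)
    (hR : ∀ n, ∀ θ ∈ Θ, ∀ i j, 0 ≤ R n θ i j ∧ R n θ i j ≤ e ((i : ℤ) - j).natAbs)
    (hW : ∀ n, ∀ θ ∈ Θ, ∀ i j k l, W n i j ≤ W n k l → R n θ k l ≤ R n θ i j)
    (hcR : ∀ n, ∀ θ ∈ Θ, ∀ z, c * (z ⬝ᵥ z) ≤ z ⬝ᵥ R n θ *ᵥ z) :
    Tendsto (fun n : ℕ => P {ω | ∃ θ ∈ Θ, ε * n ≤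
      |(fun i => Y (x n i) ω) ⬝ᵥ (R n θ)⁻¹ *ᵥ (fun i => Y (x n i) ω) -
        ((R n θ)⁻¹ * R n θ₀).trace|}) atTop (nhds 0) := by
  obtain ⟨C, hC, heC⟩ : ∃ C : ℝ, 0 < C ∧ 2 * ∑' k, e k ≤ C :=
    ⟨2 * ∑' k, e k + 1, by have : 0 ≤ ∑' k, e k := tsum_nonneg he0; positivity, by linarith⟩
  -- Four errors of εn/4: the deviations of the forms of M and N, and tr(N R_θ₀) twice, once for the
  -- sample and once for the mean.
  obtain ⟨K, N, m, hm, hev⟩ := exists_bracketing_inverse (V := V) hA hC hc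
    (show 0 < ε / 4 by positivity) he he0 heA heC
  set D : ℝ := varSqGaussian * (m * C) ^ 2 with hD
  set J := Fin K → Fin (N + 1)
  have hlim : Tendsto (fun n : ℕ => (Fintype.card J : ENNReal) *
      (2 * ENNReal.ofReal (16 * D / ε ^ 2 / n))) atTop (nhds 0) := by
    have h1 : Tendsto (fun n : ℕ => ENNReal.ofReal (16 * D / ε ^ 2 / n)) atTop (nhds 0) := by
      rw [← ENNReal.ofReal_zero]
      exact ENNReal.tendsto_ofReal (tendsto_const_div_atTop_nhds_zero_nat _)
    have h2 := ENNReal.Tendsto.const_mul (a := 2) h1 (Or.inr (by norm_num))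
    rw [mul_zero] at h2
    have h3 := ENNReal.Tendsto.const_mul (a := (Fintype.card J : ENNReal)) h2
      (Or.inr (ENNReal.natCast_ne_top _))
    rwa [mul_zero] at h3
  refine tendsto_of_tendsto_of_tendsto_of_le_of_le' tendsto_const_nhds hlim
    (Eventually.of_forall fun _ => zero_le) ?_
  filter_upwards [hev, eventually_gt_atTop 0] with n hn hn0
  have hnR : (0 : ℝ) < n := by exact_mod_cast hn0
  have hsymm₀ : (R n θ₀).IsSymm := by
    have := hherm n θ₀ hθ₀
    rwa [IsHermitian, conjTranspose_eq_transpose_of_trivial] at this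
  have hCR : ∀ z, z ⬝ᵥ R n θ₀ *ᵥ z ≤ C * (z ⬝ᵥ z) := fun z =>
    (le_abs_self _).trans (sum_abs_mul_mul_le hsymm₀ (fun i => by
      refine le_trans (Finset.sum_le_sum fun j _ => ?_)
        ((sum_natAbs_sub_le_tsum he he0 i).trans heC)
      rw [abs_of_nonneg (hR n θ₀ hθ₀ i j).1]
      exact (hR n θ₀ hθ₀ i j).2) z)
  have hpos₀ := posDef_of_le_dotProduct_mulVec (hherm n θ₀ hθ₀) hc (hcR n θ₀ hθ₀)
  obtain ⟨M, N', hM, hN', htr, hcov⟩ := hn Θ (R n) (W n) (R n θ₀) (hherm n) (hR n) (hW n) (hcR n)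
    hCR
  let y : Ω → Fin n → ℝ := fun ω i => Y (x n i) ω
  let q : Matrix (Fin n) (Fin n) ℝ → Set Ω := fun M =>
    {ω | ε / 4 * n ≤ |y ω ⬝ᵥ M *ᵥ y ω - (M * R n θ₀).trace|}
  have hq : ∀ M : Matrix (Fin n) (Fin n) ℝ, M.IsHermitian →
      (∀ z, |z ⬝ᵥ M *ᵥ z| ≤ m * (z ⬝ᵥ z)) → P (q M) ≤ ENNReal.ofReal (16 * D / ε ^ 2 / n) := by
    intro M hM hMm
    refine (measure_quadraticForm_le (y := fun i => Y (x n i)) (hY.hasGaussianLaw (x n))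
      (fun i => hY.2.1 _) (fun i j => by rw [hY.2.2, hR₀]; rfl) hpos₀ hM hm
      (show 0 < ε / 4 * n by positivity) hCR hMm).trans (le_of_eq ?_)
    rw [Fintype.card_fin, ← hD]
    congr 1
    field_simp
    ring
  have hsub : {ω | ∃ θ ∈ Θ, ε * n ≤ |y ω ⬝ᵥ (R n θ)⁻¹ *ᵥ y ω - ((R n θ)⁻¹ * R n θ₀).trace|} ⊆
      ⋃ v : J, q (M v) ∪ q (N' v) := by
    rintro ω ⟨θ, hθ, hω⟩
    obtain ⟨v, hv⟩ := hcov θ hθ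
    refine Set.mem_iUnion.2 ⟨v, ?_⟩
    by_contra hcon
    simp only [q, Set.mem_union, Set.mem_ofPred_eq, not_or, not_le] at hcon
    obtain ⟨h1, h2⟩ := hcon
    have h3 := hv (y ω)
    have h4 : ((R n θ)⁻¹ * R n θ₀).trace - (M v * R n θ₀).trace ≤ (N' v * R n θ₀).trace := by
      rw [← trace_sub, ← Matrix.sub_mul]
      refine trace_mul_le_trace_mul hpos₀.posSemidef fun z => ?_
      rw [sub_mulVec, dotProduct_sub]
      exact (abs_le.1 (hv z)).2
    have h5 : (M v * R n θ₀).trace - ((R n θ)⁻¹ * R n θ₀).trace ≤ (N' v * R n θ₀).trace := by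
      rw [← trace_sub, ← Matrix.sub_mul]
      refine trace_mul_le_trace_mul hpos₀.posSemidef fun z => ?_
      rw [sub_mulVec, dotProduct_sub]
      linarith [(abs_le.1 (hv z)).1]
    have h6 := htr v
    rw [abs_lt] at h1 h2
    rw [abs_le] at h3
    refine absurd hω (not_le.2 (abs_lt.2 ⟨?_, ?_⟩)) <;> linarith [h1.1, h1.2, h2.1, h2.2, h3.1, h3.2]
  refine (measure_mono hsub).trans ((measure_iUnion_fintype_le P _).trans ?_)
  refine (Finset.sum_le_card_nsmul _ _ (2 * ENNReal.ofReal (16 * D / ε ^ 2 / n)) fun v _ => ?_).trans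
    (by rw [nsmul_eq_mul, Finset.card_univ])
  refine (measure_union_le _ _).trans ?_
  rw [two_mul]
  exact add_le_add (hq _ (hM v).1 (hM v).2) (hq _ (hN' v).1 (hN' v).2)

end UniformLaw

/-! ### Decay, identifiability and the likelihood -/

/-- The polynomially decaying bound of the covariance of two points of the array. -/
def decayEnvelope (A L τ : ℝ) (k : ℕ) : ℝ := A / (1 + max 0 ((k : ℝ) - L) ^ (1 + τ))

lemma decayEnvelope_nonneg {A L τ : ℝ} (hA : 0 ≤ A) (k : ℕ) : 0 ≤ decayEnvelope A L τ k := by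
  unfold decayEnvelope
  positivity

lemma decayEnvelope_le {A L τ : ℝ} (hA : 0 ≤ A) (k : ℕ) : decayEnvelope A L τ k ≤ A :=
  div_le_self hA (le_add_of_nonneg_right (by positivity))

lemma summable_decayEnvelope {A L τ : ℝ} (hA : 0 ≤ A) (hτ : 0 < τ) :
    Summable (decayEnvelope A L τ) := by
  rw [← summable_nat_add_iff ⌈L⌉₊]
  have h := (Real.summable_one_div_nat_rpow.2 (show 1 < 1 + τ by linarith)).mul_left A
  -- This shift avoids index 0, where the comparison series has the default value of a division by
  -- zero.
  rw [← summable_nat_add_iff 1] at h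
  rw [← summable_nat_add_iff 1]
  refine Summable.of_nonneg_of_le (fun k => decayEnvelope_nonneg hA _) (fun k => ?_) h
  rw [mul_one_div]
  refine div_le_div_of_nonneg_left hA (by positivity) ?_
  have h1 : ((k + 1 : ℕ) : ℝ) ≤ max 0 (((k + 1 + ⌈L⌉₊ : ℕ) : ℝ) - L) := by
    refine le_trans ?_ (le_max_right _ _)
    have := Nat.le_ceil L
    push_cast
    linarith
  have h2 := Real.rpow_le_rpow (by positivity) h1 (show 0 ≤ 1 + τ by linarith)
  linarith

/-- The Wasserstein distances in an array with shifted supports. -/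
lemma le_W2_of_shiftedSupports {μ : (n : ℕ) → Fin n → WassersteinSpace} {L : ℝ}
    (hL : ∀ (n : ℕ) (i : Fin n),
      (μ n i).measure.support ⊆ Set.Icc ((i : ℝ) + 1) ((i : ℝ) + 1 + L)) (n : ℕ) (i j : Fin n) :
    max 0 ((((i : ℤ) - j).natAbs : ℝ) - L) ≤ W2 (μ n i) (μ n j) := by
  refine le_W2_of_support (le_max_left _ _) fun x hx y hy => max_le (abs_nonneg _) ?_
  have h1 := hL n i hx
  have h2 := hL n j hy
  rw [Nat.cast_natAbs]
  push_cast
  rw [sub_le_iff_le_add]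
  refine abs_le.2 ⟨?_, ?_⟩
  · have := neg_abs_le (x - y)
    linarith [h1.1, h1.2, h2.1, h2.2]
  · have := le_abs_self (x - y)
    linarith [h1.1, h1.2, h2.1, h2.2]

/-- A nonincreasing function lies above its limit at infinity, which the decay makes zero. -/
lemma nonneg_of_antitoneOn_of_decay {F : ℝ → ℝ} {A τ : ℝ} (hτ : 0 < τ)
    (hF : AntitoneOn F (Set.Ici 0)) (hdecay : ∀ t, 0 ≤ t → |F t| ≤ A / (1 + |t| ^ (1 + τ)))
    {t : ℝ} (ht : 0 ≤ t) : 0 ≤ F t := by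
  have h1 : Tendsto (fun s : ℝ => A / (1 + |s| ^ (1 + τ))) atTop (nhds 0) := by
    refine tendsto_const_nhds.div_atTop (tendsto_atTop_add_const_left _ _ ?_)
    exact (tendsto_rpow_atTop (by linarith)).comp tendsto_abs_atTop_atTop
  have h2 : Tendsto F atTop (nhds 0) := by
    refine squeeze_zero_norm' ?_ h1
    filter_upwards [eventually_ge_atTop 0] with s hs using hdecay s hs
  refine le_of_tendsto h2 ?_
  filter_upwards [eventually_ge_atTop t] with s hs using hF ht (ht.trans hs) hs

lemma IsCovarianceFunction.isHermitian_covMatrix {E : Type*} {K : E → E → ℝ}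
    (hK : IsCovarianceFunction K) {n : ℕ} (x : Fin n → E) : (covMatrix K x).IsHermitian := by
  ext i j
  simp [covMatrix, hK.1 (x j) (x i)]

lemma AsymptoticallyIdentifiable.exists_pos {E V : Type*} [NormedAddCommGroup V]
    {K : V → E → E → ℝ} {Θ : Set V} {x : (n : ℕ) → Fin n → E} {θ₀ : V}
    (h : AsymptoticallyIdentifiable K Θ x θ₀) {α : ℝ} (hα : 0 < α) :
    ∃ δ : ℝ, 0 < δ ∧ ∀ᶠ n : ℕ in atTop, ∀ θ ∈ Θ, α ≤ ‖θ - θ₀‖ →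
      δ * n ≤ ∑ i, ∑ j, (K θ (x n i) (x n j) - K θ₀ (x n i) (x n j)) ^ 2 := by
  obtain ⟨δ, hδ0, hδ⟩ := EReal.lt_iff_exists_real_btwn.1 (h α hα)
  refine ⟨δ, by exact_mod_cast hδ0, ?_⟩
  filter_upwards [eventually_lt_of_lt_liminf hδ, eventually_gt_atTop 0] with n hn hn0 θ hθ hα'
  have h1 := hn.trans_le (iInf₂_le θ ⟨hθ, hα'⟩)
  have h2 := EReal.coe_lt_coe_iff.1 h1
  rw [one_div_mul_eq_div, lt_div_iff₀ (by exact_mod_cast hn0)] at h2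
  exact h2.le

/-- An estimator at a distance from the true parameter forces a large deviation of one of the
quadratic forms in the likelihood. -/
lemma IsMaximumLikelihood.exists_deviation {E V : Type*} {n : ℕ} {K : V → E → E → ℝ} {Θ : Set V}
    {x : Fin n → E} {y : Fin n → ℝ} {θ θ₀ : V} (h : IsMaximumLikelihood K Θ x y θ)
    (hθ₀ : θ₀ ∈ Θ) (hn : 0 < n) {η : ℝ}
    (hdet : IsUnit (covMatrix (K θ₀) x).det)
    (hKL : 2 * η * n ≤ Real.log (covMatrix (K θ) x).det - Real.log (covMatrix (K θ₀) x).det +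
      ((covMatrix (K θ) x)⁻¹ * covMatrix (K θ₀) x).trace - n) :
    ∃ θ' ∈ Θ, η * n ≤ |y ⬝ᵥ (covMatrix (K θ') x)⁻¹ *ᵥ y -
      ((covMatrix (K θ') x)⁻¹ * covMatrix (K θ₀) x).trace| := by
  by_contra! hcon
  -- If both deviations were below ηn, the criterion at `θ` would exceed that at `θ₀`, against
  -- minimality.
  have h1 := (abs_lt.1 (hcon θ h.1)).1
  have h2 := (abs_lt.1 (hcon θ₀ hθ₀)).2
  have h3 := h.2 θ₀ hθ₀
  rw [nonsing_inv_mul _ hdet, trace_one, Fintype.card_fin] at h2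
  simp only [likelihoodCriterion] at h3
  rw [← mul_add, ← mul_add] at h3
  have h4 := le_of_mul_le_mul_left h3 (by positivity)
  linarith

end WassersteinGP

end

/-! ### Consistency -/

theorem mainTheorem4 {p : ℕ} (Θ : Set (EuclideanSpace ℝ (Fin p)))
    (K : EuclideanSpace ℝ (Fin p) → WassersteinGP.WassersteinSpace →
      WassersteinGP.WassersteinSpace → ℝ)
    (hK : ∀ θ ∈ Θ, WassersteinGP.IsCovarianceFunction (K θ))
    (μ : (n : ℕ) → Fin n → WassersteinGP.WassersteinSpace)
    (θ₀ : EuclideanSpace ℝ (Fin p))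
    {Ω : Type*} [MeasurableSpace Ω] (P : Measure Ω) [IsProbabilityMeasure P]
    (Y : WassersteinGP.WassersteinSpace → Ω → ℝ)
    (hsupport : WassersteinGP.ShiftedSupports μ)
    (hdecay : WassersteinGP.StationaryWithDecay K Θ)
    (hθ₀ : θ₀ ∈ Θ)
    (hY : WassersteinGP.IsCenteredGaussianProcess Y (K θ₀) P)
    (heigen : WassersteinGP.EigenvaluesBoundedBelow K Θ μ)
    (hident : WassersteinGP.AsymptoticallyIdentifiable K Θ μ θ₀)
    (θML : ℕ → Ω → EuclideanSpace ℝ (Fin p))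
    (hML : ∀ n : ℕ, ∀ᵐ ω ∂P,
      WassersteinGP.IsMaximumLikelihood K Θ (μ n) (fun i => Y (μ n i) ω) (θML n ω)) :
    TendstoInMeasure P θML atTop (fun _ => θ₀) := by
  open WassersteinGP Matrix in
  obtain ⟨L, hL⟩ := hsupport
  obtain ⟨F, A, τ, hτ, hF, hFA⟩ := hdecay
  obtain ⟨c, hc, hceig⟩ := heigen
  have hτ0 : 0 < τ := zero_lt_one.trans hτ
  have hA0 : 0 ≤ A := by
    have := (abs_nonneg _).trans (hFA θ₀ hθ₀ 0 le_rfl)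
    rw [abs_zero, Real.zero_rpow (by linarith), add_zero, div_one] at this
    exact this
  -- `A` may vanish, whereas the bracketing needs a positive bound.
  have hA : 0 < A + 1 := by linarith
  have hanti : ∀ θ ∈ Θ, AntitoneOn (F θ) (Set.Ici 0) := fun θ hθ =>
    (hK θ hθ).antitoneOn (hF θ hθ)
  have hW0 : ∀ ν ν' : WassersteinSpace, 0 ≤ W2 ν ν' := fun _ _ => Real.sqrt_nonneg _
  set e := decayEnvelope (A + 1) L τ with he_def
  have he : Summable e := summable_decayEnvelope hA.le hτ0
  have he0 : ∀ k, 0 ≤ e k := decayEnvelope_nonneg hA.le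
  have hherm : ∀ n, ∀ θ ∈ Θ, (covMatrix (K θ) (μ n)).IsHermitian := fun n θ hθ =>
    (hK θ hθ).isHermitian_covMatrix _
  have hR : ∀ n, ∀ θ ∈ Θ, ∀ i j, 0 ≤ covMatrix (K θ) (μ n) i j ∧
      covMatrix (K θ) (μ n) i j ≤ e ((i : ℤ) - j).natAbs := by
    intro n θ hθ i j
    have h1 : covMatrix (K θ) (μ n) i j = F θ (W2 (μ n i) (μ n j)) := hF θ hθ _ _
    rw [h1]
    refine ⟨nonneg_of_antitoneOn_of_decay hτ0 (hanti θ hθ) (hFA θ hθ) (hW0 _ _), ?_⟩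
    refine (le_abs_self _).trans ((hFA θ hθ _ (hW0 _ _)).trans ?_)
    rw [abs_of_nonneg (hW0 _ _)]
    have h2 := Real.rpow_le_rpow (le_max_left _ _) (le_W2_of_shiftedSupports hL n i j)
      (show 0 ≤ 1 + τ by linarith)
    rw [he_def, decayEnvelope]
    gcongr
    linarith
  have hmono : ∀ n, ∀ θ ∈ Θ, ∀ i j k l, W2 (μ n i) (μ n j) ≤ W2 (μ n k) (μ n l) →
      covMatrix (K θ) (μ n) k l ≤ covMatrix (K θ) (μ n) i j := by
    intro n θ hθ i j k l h
    have h1 : ∀ i j, covMatrix (K θ) (μ n) i j = F θ (W2 (μ n i) (μ n j)) := fun _ _ =>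
      hF θ hθ _ _
    rw [h1, h1]
    exact hanti θ hθ (hW0 _ _) (hW0 _ _) h
  have hcR : ∀ n, ∀ θ ∈ Θ, ∀ z, c * (z ⬝ᵥ z) ≤ z ⬝ᵥ covMatrix (K θ) (μ n) *ᵥ z :=
    fun n θ hθ => le_dotProduct_mulVec_of_hasEigenvalue (hherm n θ hθ) (hceig n θ hθ)
  obtain ⟨C, hC, heC⟩ : ∃ C : ℝ, 0 < C ∧ 2 * ∑' k, e k ≤ C :=
    ⟨2 * ∑' k, e k + 1, by have : 0 ≤ ∑' k, e k := tsum_nonneg he0; positivity, by linarith⟩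
  have hCR : ∀ n, ∀ θ ∈ Θ, ∀ z, z ⬝ᵥ covMatrix (K θ) (μ n) *ᵥ z ≤ C * (z ⬝ᵥ z) := by
    intro n θ hθ z
    have hsymm : (covMatrix (K θ) (μ n)).IsSymm := by
      have := hherm n θ hθ
      rwa [IsHermitian, conjTranspose_eq_transpose_of_trivial] at this
    refine (le_abs_self _).trans (sum_abs_mul_mul_le hsymm (fun i => ?_) z)
    refine le_trans (Finset.sum_le_sum fun j _ => ?_)
      ((sum_natAbs_sub_le_tsum he he0 i).trans heC)
    rw [abs_of_nonneg (hR n θ hθ i j).1]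
    exact (hR n θ hθ i j).2
  rw [tendstoInMeasure_iff_norm]
  intro α hα
  obtain ⟨δ, hδ, hident'⟩ := hident.exists_pos hα
  set κ := C ^ 2 * (C / c * (2 * (C / c) + 2)) with hκ
  have hκ0 : 0 < κ := by positivity
  -- The divergence is at least (δ/κ)n away from θ₀; half of it is allotted to each of the two
  -- deviations.
  have hlim := tendsto_measure_exists_deviation hY μ Θ (fun n θ => covMatrix (K θ) (μ n))
    (fun n i j => W2 (μ n i) (μ n j)) hA hc (show 0 < δ / κ / 2 by positivity) he he0
    (decayEnvelope_le hA.le) hθ₀ (fun _ => rfl) hherm hR hmono hcR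
  refine tendsto_of_tendsto_of_tendsto_of_le_of_le' tendsto_const_nhds hlim
    (Eventually.of_forall fun _ => zero_le) ?_
  filter_upwards [hident', eventually_gt_atTop 0] with n hn hn0
  refine measure_mono_ae ?_
  filter_upwards [hML n] with ω hω hdist
  have hθ := hω.1
  refine hω.exists_deviation hθ₀ hn0 ?_ ?_
  · exact (isUnit_iff_isUnit_det _).1
      (posDef_of_le_dotProduct_mulVec (hherm n θ₀ hθ₀) hc (hcR n θ₀ hθ₀)).isUnit
  · have h1 := frobenius_le_kullbackLeibler (hherm n θ₀ hθ₀) (hherm n _ hθ) hc hC (hcR n θ₀ hθ₀)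
      (hCR n θ₀ hθ₀) (hcR n _ hθ) (hCR n _ hθ)
    rw [Fintype.card_fin, ← hκ] at h1
    refine le_trans ?_ h1
    rw [le_div_iff₀ hκ0]
    refine le_trans (le_of_eq ?_) (hn _ hθ hdist)
    field_simp
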